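/- Let $G=(V,E)$ be an infinite, countable, connected graph which is quasi-transitive, i.e. the automorphism group of $G$ has only finitely many orbits on $V$. Consider on $G$ either independent Bernoulli bond percolation, where each edge is open with probability $p\in[0,1]$ independently of all other edges and $G(\omega)$ is the graph with vertex set $V$ whose edges are the open edges, or independent Bernoulli site percolation, where each vertex is open with probability $p$ independently of all other vertices and $G(\omega)$ is the subgraph of $G$ induced by the open vertices. Let $C_x$ be the connected component of $G(\omega)$ that contains the vertex $x$ (with $C_x=\emptyset$ if $x$ is a closed vertex in site percolation), let $|C_x|$ be its number of vertices, and put $$p_T:=\sup\{p\in[0,1]:\ \mathbb{E}_p(|C_x|)<\infty\},\qquad p_H:=\sup\{p\in[0,1]:\ \mathbb{P}_p(|C_x|=\infty)=0\}.$$ Then, for both models, $p_T$ and $p_H$ do not depend on the choice of the vertex $x$, and $$p_T=p_H .$$ In particular, for every $p<p_H$, almost surely all clusters are finite, and $\mathbb{E}_p(|C_x|)<\infty$ for every vertex $x$. -/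

import Mathlib

open MeasureTheory ProbabilityTheory unitInterval

/-- A graph is quasi-transitive if some finite set of vertices meets every orbit of its
automorphism group. -/
def IsQuasiTransitive {V : Type*} (G : SimpleGraph V) : Prop :=
  ∃ F : Finset V, ∀ x : V, ∃ y ∈ F, ∃ γ : G ≃g G, γ y = x

namespace Percolation

/-- The percolation measure on configurations `ω : S → Bool`: the states of the elements of `S`
are independent, each one being open (`true`) with probability `p`. -/
noncomputable def measure (S : Type*) (p : I) : Measure (S → Bool) :=
  Measure.infinitePi fun _ : S => bernoulliMeasure true false p

/-- Bond percolation: the subgraph of `G` with all vertices of `G` and only the open edges. -/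
def bondGraph {V : Type*} (G : SimpleGraph V) (ω : G.edgeSet → Bool) : SimpleGraph V where
  Adj x y := ∃ h : s(x, y) ∈ G.edgeSet, ω ⟨s(x, y), h⟩ = true
  symm := ⟨by
    intro x y h
    rwa [Sym2.eq_swap] at h⟩
  loopless := ⟨by
    rintro x ⟨h, -⟩
    exact G.loopless.irrefl x h⟩

/-- Bond percolation: the vertex set of the connected component of `x`. -/
def bondCluster {V : Type*} (G : SimpleGraph V) (ω : G.edgeSet → Bool) (x : V) : Set V :=
  {y | (bondGraph G ω).Reachable x y}

/-- Site percolation: the subgraph of `G` induced by the open vertices. -/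
def siteGraph {V : Type*} (G : SimpleGraph V) (ω : V → Bool) :
    SimpleGraph {v : V | ω v = true} :=
  G.induce {v : V | ω v = true}

/-- Site percolation: the vertex set of the connected component of `x`; it is empty if `x` is
closed. -/
def siteCluster {V : Type*} (G : SimpleGraph V) (ω : V → Bool) (x : V) : Set V :=
  {y | ∃ (hx : ω x = true) (hy : ω y = true), (siteGraph G ω).Reachable ⟨x, hx⟩ ⟨y, hy⟩}

/-- The expectation of the number of vertices of the cluster of `x` (a value in `[0, ∞]`), where
`C ω x` is the cluster of `x` in the configuration `ω`. -/
noncomputable def expectedSize {S V : Type*} (C : (S → Bool) → V → Set V) (p : I) (x : V) :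
    ENNReal :=
  ∫⁻ ω, ((C ω x).encard : ENNReal) ∂(measure S p)

/-- `p_T`: the supremum of all `p ∈ [0, 1]` such that the expected size of the cluster of `x` is
finite. -/
noncomputable def pT {S V : Type*} (C : (S → Bool) → V → Set V) (x : V) : ℝ :=
  sSup {q : ℝ | ∃ p : I, (p : ℝ) = q ∧ expectedSize C p x < ⊤}

/-- `p_H`: the supremum of all `p ∈ [0, 1]` such that the cluster of `x` is infinite with
probability `0`. -/
noncomputable def pH {S V : Type*} (C : (S → Bool) → V → Set V) (x : V) : ℝ :=
  sSup {q : ℝ | ∃ p : I, (p : ℝ) = q ∧ measure S p {ω | (C ω x).Infinite} = 0}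

end Percolation

/-!
The proof follows the argument of Duminil-Copin and Tassion for sharpness, carried out for site
percolation; bond percolation on `G` is site percolation on the line graph of `G`, with the very
same configuration space.

For a finite set `S` containing `x`, let `boundarySize G p S x` be the expected number of vertices
outside `S` adjacent to the cluster of `x` in `S`, where `x` is regarded as open. On a locally finite
graph, the critical point is the supremum of the `p` that are subcritical: every vertex `x` has a
finite `S` with `p * boundarySize G p S x < 1`.

* If `p` is subcritical, conditioning on the cluster of `x` in `S` gives the inequality of Simon and
  Lieb (`measure_conn_le`). By quasi-transitivity, `S` can be chosen with bounded size and with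
  `p * boundarySize G p S x` bounded away from `1`, so that summing this inequality over all end
  points bounds the expected cluster size (`tsum_measure_conn_le`).
* If `p` is not subcritical, there is a vertex `x` with `1 ≤ boundarySize G q S x` for all `q ≥ p`
  and all `S`. Let `g` be the probability that `x` is connected to the outside of a finite set `Λ`.
  Conditioning on the set `S` of all vertices that are not connected to the outside, the vertices
  adjacent to the cluster of `x` in `S` are pivotal, so Russo's formula yields `g' ≥ 1 - g` on
  `[p, 1]` (`measure_compl_exits_le`). Integration bounds `g` away from `0` above `p`, uniformly
  in `Λ`, so the cluster of `x` is infinite with positive probability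
  (`measure_infinite_conn_ne_zero`), and by connectedness this holds for all vertices.

If some vertex has infinitely many neighbours, infinitely many of them are open for any `p > 0`, and
the critical point is `0` (`isSharp_siteCluster_zero`).
-/

/-! ### The percolation measure: independence, Russo's formula, monotonicity -/

namespace Percolation

section Measure

variable {S : Type*}

instance isProbabilityMeasure_measure (p : I) : IsProbabilityMeasure (measure S p) := by
  unfold measure; infer_instance

/-- The event that `s` is open. -/
def openAt (s : S) : Set (S → Bool) := {ω | ω s = true}

lemma measurableSet_openAt (s : S) : MeasurableSet (openAt s) := by
  have h : Measurable fun ω : S → Bool => ω s := measurable_pi_apply s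
  exact h (measurableSet_singleton true)

lemma measure_eval_preimage (p : I) (s : S) (t : Set Bool) :
    measure S p {ω | ω s ∈ t} = bernoulliMeasure true false p t := by
  have h := (measurePreserving_eval_infinitePi
    (fun _ : S => bernoulliMeasure true false p) s).measure_preimage
    (MeasurableSet.of_discrete (s := t)).nullMeasurableSet
  exact h

lemma measureReal_openAt (p : I) (s : S) : (measure S p).real (openAt s) = p := by
  have h := measure_eval_preimage p s {true}
  have h' : {ω : S → Bool | ω s ∈ ({true} : Set Bool)} = openAt s := rfl
  rw [h'] at h
  rw [measureReal_def, h, ← measureReal_def,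
    bernoulliMeasure_real_apply_of_mem_of_notMem _ _ (by simp) (by simp)]
  exact MeasurableSet.of_discrete

lemma measure_openAt (p : I) (s : S) : measure S p (openAt s) = ENNReal.ofReal p := by
  rw [← measureReal_openAt p s, ofReal_measureReal]

lemma iIndepFun_eval (p : I) : iIndepFun (fun (s : S) (ω : S → Bool) => ω s) (measure S p) := by
  have := iIndepFun_infinitePi (P := fun _ : S => bernoulliMeasure true false p)
    (X := fun _ b => b) (fun _ => measurable_id)
  exact this

lemma measurableSet_iSup_of_dependsOn {A : Set (S → Bool)} {s : Set S} (hA : MeasurableSet A)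
    (dA : DependsOn (· ∈ A) s) :
    MeasurableSet[⨆ i ∈ s, MeasurableSpace.comap (fun ω : S → Bool => ω i) inferInstance] A := by
  classical
  let r : (S → Bool) → (S → Bool) := fun ω i => if i ∈ s then ω i else false
  have hr : Measurable[⨆ i ∈ s, MeasurableSpace.comap (fun ω : S → Bool => ω i) inferInstance] r := by
    refine @measurable_pi_lambda _ _ _ (_) _ _ fun i => ?_
    by_cases hi : i ∈ s
    · simp only [r, hi, if_true]
      refine Measurable.mono (comap_measurable _) ?_ le_rfl
      exact le_iSup₂_of_le i hi le_rfl
    · simp only [r, hi, if_false]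
      exact @measurable_const _ _ _ (_) _
  have : A = r ⁻¹' A := by
    ext ω
    have := dA (x := ω) (y := r ω) (fun i hi => by simp [r, hi])
    exact iff_of_eq this
  rw [this]
  exact hr hA

/-- Events that depend on disjoint sets of coordinates are independent. -/
lemma measure_inter_of_dependsOn (p : I) {A B : Set (S → Bool)} {s t : Set S} (hst : Disjoint s t)
    (hA : MeasurableSet A) (hB : MeasurableSet B)
    (dA : DependsOn (· ∈ A) s) (dB : DependsOn (· ∈ B) t) :
    measure S p (A ∩ B) = measure S p A * measure S p B := by
  have h := indep_iSup_of_disjoint (fun i => (measurable_pi_apply i).comap_le)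
    (iIndepFun_eval (S := S) p).iIndep hst
  rw [Indep_iff] at h
  exact h A B (measurableSet_iSup_of_dependsOn hA dA) (measurableSet_iSup_of_dependsOn hB dB)

lemma dependsOn_openAt (s : S) : DependsOn (· ∈ openAt s) {s} := by
  intro ω ω' h
  simp [openAt, h s rfl]

open Function in
lemma dependsOn_update [DecidableEq S] (A : Set (S → Bool)) (s : S) (b : Bool) :
    DependsOn (· ∈ {ω | update ω s b ∈ A}) {s}ᶜ := by
  intro ω ω' h
  have : update ω s b = update ω' s b := by
    ext i
    by_cases hi : i = s
    · subst hi; simp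
    · simp [hi, h i hi]
  simp [this]

open Function in
lemma measurableSet_update [DecidableEq S] {A : Set (S → Bool)} (hA : MeasurableSet A) (s : S)
    (b : Bool) : MeasurableSet {ω : S → Bool | update ω s b ∈ A} := by
  have h : Measurable fun ω : S → Bool => update ω s b := measurable_update_left
  exact h hA

/-- The state of `s` is pivotal for `A`: opening `s` makes `A` happen, closing it prevents `A`. -/
def pivotal [DecidableEq S] (A : Set (S → Bool)) (s : S) : Set (S → Bool) :=
  {ω | Function.update ω s true ∈ A ∧ Function.update ω s false ∉ A}

lemma measureReal_inter_of_dependsOn (p : I) {A B : Set (S → Bool)} {s t : Set S}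
    (hst : Disjoint s t) (hA : MeasurableSet A) (hB : MeasurableSet B)
    (dA : DependsOn (· ∈ A) s) (dB : DependsOn (· ∈ B) t) :
    (measure S p).real (A ∩ B) = (measure S p).real A * (measure S p).real B := by
  simp only [measureReal_def, measure_inter_of_dependsOn p hst hA hB dA dB, ENNReal.toReal_mul]

lemma measureReal_compl_openAt (p : I) (s : S) : (measure S p).real (openAt s)ᶜ = 1 - p := by
  rw [probReal_compl_eq_one_sub (measurableSet_openAt s), measureReal_openAt]

/-- The covariance of an increasing event and the state of `s`. -/
lemma measureReal_inter_openAt_sub [DecidableEq S] (p : I) {A : Set (S → Bool)}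
    (hA : MeasurableSet A) (hup : IsUpperSet A) (s : S) :
    (measure S p).real (A ∩ openAt s) - p * (measure S p).real A =
      p * (1 - p) * (measure S p).real (pivotal A s) := by
  set A1 : Set (S → Bool) := {ω | Function.update ω s true ∈ A}
  set A0 : Set (S → Bool) := {ω | Function.update ω s false ∈ A}
  have h1 : A ∩ openAt s = openAt s ∩ A1 := by
    ext ω
    simp only [openAt, Set.mem_inter_iff, Set.mem_ofPred_eq, A1, and_comm]
    refine and_congr_right fun h => ?_
    rw [← h, Function.update_eq_self]
  have h0 : A ∩ (openAt s)ᶜ = (openAt s)ᶜ ∩ A0 := by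
    ext ω
    simp only [openAt, Set.mem_inter_iff, Set.mem_ofPred_eq, A0, Set.mem_compl_iff,
      Bool.not_eq_true, and_comm]
    refine and_congr_right fun h => ?_
    rw [← h, Function.update_eq_self]
  have m1 := measurableSet_update hA s true
  have m0 := measurableSet_update hA s false
  have e1 : (measure S p).real (A ∩ openAt s) = p * (measure S p).real A1 := by
    rw [h1, measureReal_inter_of_dependsOn p disjoint_compl_right (measurableSet_openAt s) m1
      (dependsOn_openAt s) (dependsOn_update A s true), measureReal_openAt]
  have dc : DependsOn (· ∈ (openAt s)ᶜ) ({s} : Set S) := by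
    intro ω ω' h
    simp [openAt, h s rfl]
  have e0 : (measure S p).real (A ∩ (openAt s)ᶜ) = (1 - p) * (measure S p).real A0 := by
    rw [h0, measureReal_inter_of_dependsOn p disjoint_compl_right (measurableSet_openAt s).compl m0
      dc (dependsOn_update A s false), measureReal_compl_openAt]
  have e : (measure S p).real A =
      (measure S p).real (A ∩ openAt s) + (measure S p).real (A ∩ (openAt s)ᶜ) := by
    rw [← Set.sdiff_eq, measureReal_inter_add_sdiff (measurableSet_openAt s)]
  have hsub : A0 ⊆ A1 := by
    intro ω h
    refine hup ?_ h
    intro i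
    by_cases hi : i = s
    · subst hi; simp
    · simp [hi]
  have hp : (measure S p).real (pivotal A s) = (measure S p).real A1 - (measure S p).real A0 := by
    rw [← measureReal_sdiff hsub m0]; rfl
  rw [hp, e, e1, e0]; ring

/-- The configuration whose set of open elements is `B`. -/
def indicatorConfig [DecidableEq S] (B : Finset S) : S → Bool := fun s => decide (s ∈ B)

/-- The probability of an event `A` that depends on the finite set `Λ` of coordinates, as a
polynomial in `p`. -/
noncomputable def cylProb [DecidableEq S] (Λ : Finset S) (A : Set (S → Bool)) (p : ℝ) : ℝ :=
  open Classical in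
  ∑ B ∈ Λ.powerset, if indicatorConfig B ∈ A then p ^ B.card * (1 - p) ^ (Λ \ B).card else 0

/-- The configurations that agree with `indicatorConfig B` on `Λ`. -/
def cylinderOf [DecidableEq S] (Λ B : Finset S) : Set (S → Bool) :=
  {ω | ∀ i ∈ Λ, ω i = indicatorConfig B i}

lemma cylinderOf_eq_pi [DecidableEq S] (Λ B : Finset S) :
    cylinderOf Λ B = Set.pi Λ fun i => {indicatorConfig B i} := by
  ext; simp [cylinderOf, Set.mem_pi]

lemma measurableSet_cylinderOf [DecidableEq S] (Λ B : Finset S) :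
    MeasurableSet (cylinderOf Λ B) := by
  rw [cylinderOf_eq_pi]
  exact MeasurableSet.pi Λ.countable_toSet fun _ _ => measurableSet_singleton _

lemma measureReal_cylinderOf [DecidableEq S] (p : I) {Λ B : Finset S} (hB : B ⊆ Λ) :
    (measure S p).real (cylinderOf Λ B) = (p : ℝ) ^ B.card * (1 - p) ^ (Λ \ B).card := by
  have ht : (bernoulliMeasure true false p).real {true} = p := by
    rw [bernoulliMeasure_real_apply_of_mem_of_notMem _ (by exact MeasurableSet.of_discrete)
      (by simp) (by simp)]
  have hf : (bernoulliMeasure true false p).real {false} = 1 - p := by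
    rw [bernoulliMeasure_real_apply_of_notMem_of_mem _ (by exact MeasurableSet.of_discrete)
      (by simp) (by simp)]
  rw [cylinderOf_eq_pi, measureReal_def, measure,
    Measure.infinitePi_pi _ (fun _ _ => measurableSet_singleton _), ENNReal.toReal_prod,
    ← Finset.sdiff_union_of_subset hB, Finset.prod_union Finset.sdiff_disjoint, mul_comm]
  congr 1
  · rw [← Finset.prod_const]
    refine Finset.prod_congr rfl fun i hi => ?_
    rw [← measureReal_def, ← ht]; simp [indicatorConfig, hi]
  · rw [Finset.sdiff_union_of_subset hB, ← Finset.prod_const]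
    refine Finset.prod_congr rfl fun i hi => ?_
    rw [← measureReal_def, ← hf]; simp [indicatorConfig, (Finset.mem_sdiff.1 hi).2]

lemma inter_cylinderOf [DecidableEq S] {Λ : Finset S} {A : Set (S → Bool)}
    (dA : DependsOn (· ∈ A) (Λ : Set S)) (B : Finset S) [Decidable (indicatorConfig B ∈ A)] :
    A ∩ cylinderOf Λ B = if indicatorConfig B ∈ A then cylinderOf Λ B else ∅ := by
  have key : ∀ ω ∈ cylinderOf Λ B, (ω ∈ A ↔ indicatorConfig B ∈ A) := fun ω h =>
    iff_of_eq (dA fun i hi => h i hi)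
  split_ifs with h
  · exact Set.inter_eq_right.2 fun ω hω => (key ω hω).2 h
  · exact Set.eq_empty_of_forall_notMem fun ω hω => h ((key ω hω.2).1 hω.1)

lemma eq_biUnion_cylinderOf [DecidableEq S] (Λ : Finset S) (A : Set (S → Bool)) :
    A = ⋃ B ∈ Λ.powerset, A ∩ cylinderOf Λ B := by
  ext ω
  simp only [Set.mem_iUnion, Set.mem_inter_iff, exists_prop]
  refine ⟨fun h => ⟨Λ.filter fun i => ω i = true, by simp, h, fun i hi => ?_⟩, ?_⟩
  · by_cases h' : ω i = true <;> simp [indicatorConfig, hi, h']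
  · rintro ⟨B, -, h, -⟩; exact h

lemma measurableSet_of_dependsOn_finset {Λ : Finset S} {A : Set (S → Bool)}
    (dA : DependsOn (· ∈ A) (Λ : Set S)) : MeasurableSet A := by
  classical
  rw [eq_biUnion_cylinderOf Λ A]
  refine Finset.measurableSet_biUnion _ fun B _ => ?_
  rw [inter_cylinderOf dA]
  split_ifs
  · exact measurableSet_cylinderOf Λ B
  · exact MeasurableSet.empty

lemma measureReal_eq_cylProb [DecidableEq S] (p : I) {Λ : Finset S} {A : Set (S → Bool)}
    (dA : DependsOn (· ∈ A) (Λ : Set S)) : (measure S p).real A = cylProb Λ A p := by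
  classical
  have hm := measurableSet_of_dependsOn_finset dA
  conv_lhs => rw [eq_biUnion_cylinderOf Λ A]
  rw [measureReal_biUnion_finset]
  · unfold cylProb
    refine Finset.sum_congr rfl fun B hB => ?_
    rw [inter_cylinderOf dA]
    split_ifs
    · exact measureReal_cylinderOf p (Finset.mem_powerset.1 hB)
    · simp
  · intro B hB C hC hBC
    refine Set.disjoint_left.2 fun ω h h' => hBC ?_
    simp only [Finset.coe_powerset, Set.mem_preimage, Set.mem_powerset_iff,
      Finset.coe_subset] at hB hC
    ext i
    by_cases hi : i ∈ Λ
    · have := (h.2 i hi).symm.trans (h'.2 i hi)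
      simpa [indicatorConfig] using this
    · exact ⟨fun h => absurd (hB h) hi, fun h => absurd (hC h) hi⟩
  · exact fun B _ => hm.inter (measurableSet_cylinderOf Λ B)

lemma continuous_cylProb [DecidableEq S] (Λ : Finset S) (A : Set (S → Bool)) :
    Continuous (cylProb Λ A) := by
  unfold cylProb
  refine continuous_finsetSum _ fun B _ => ?_
  split_ifs <;> fun_prop

lemma hasDerivAt_pow_mul_pow {p : ℝ} (h0 : p ≠ 0) (h1 : 1 - p ≠ 0) (a b : ℕ) :
    HasDerivAt (fun q : ℝ => q ^ a * (1 - q) ^ b)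
      ((p ^ a * (1 - p) ^ b) * (a - p * (a + b)) / (p * (1 - p))) p := by
  have h := (hasDerivAt_pow a p).mul (((hasDerivAt_id p).const_sub 1).pow b)
  refine h.congr_deriv ?_
  have ha : (a : ℝ) * p ^ (a - 1) = a * p ^ a / p := by
    cases a with
    | zero => simp
    | succ a => rw [eq_div_iff h0, Nat.add_sub_cancel, pow_succ]; ring
  have hb : (b : ℝ) * (1 - p) ^ (b - 1) = b * (1 - p) ^ b / (1 - p) := by
    cases b with
    | zero => simp
    | succ b => rw [eq_div_iff h1, Nat.add_sub_cancel, pow_succ]; ring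
  simp only [id, Pi.pow_apply]
  rw [ha, hb]
  field_simp
  ring

/-- **Russo's formula**: the derivative in `p` of the probability of an increasing event is the
expected number of pivotal elements. -/
theorem hasDerivAt_cylProb [DecidableEq S] {Λ : Finset S} {A : Set (S → Bool)}
    (dA : DependsOn (· ∈ A) (Λ : Set S)) (hup : IsUpperSet A) {p : I} (h0 : (0 : ℝ) < p)
    (h1 : (p : ℝ) < 1) :
    HasDerivAt (cylProb Λ A) (∑ s ∈ Λ, (measure S p).real (pivotal A s)) p := by
  classical
  have h0' : (p : ℝ) ≠ 0 := h0.ne'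
  have h1' : 1 - (p : ℝ) ≠ 0 := by linarith
  have hm := measurableSet_of_dependsOn_finset dA
  have hd : HasDerivAt (cylProb Λ A) (∑ B ∈ Λ.powerset, if indicatorConfig B ∈ A then
      (((p : ℝ) ^ B.card * (1 - p) ^ (Λ \ B).card) * (B.card - p * Λ.card) / (p * (1 - p)))
      else 0) p := by
    unfold cylProb
    refine HasDerivAt.fun_sum fun B hB => ?_
    split_ifs
    · refine (hasDerivAt_pow_mul_pow h0' h1' B.card (Λ \ B).card).congr_deriv ?_
      have : (Λ.card : ℝ) = B.card + (Λ \ B).card := by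
        rw [add_comm]
        exact_mod_cast (Finset.card_sdiff_add_card_eq_card (Finset.mem_powerset.1 hB)).symm
      rw [this]
    · exact hasDerivAt_const _ _
  refine hd.congr_deriv ?_
  have hpiv : ∀ s ∈ Λ, (measure S p).real (pivotal A s) =
      (cylProb Λ (A ∩ openAt s) p - p * cylProb Λ A p) / (p * (1 - p)) := by
    intro s hs
    have dA' : DependsOn (· ∈ A ∩ openAt s) (Λ : Set S) := by
      intro ω ω' h
      have := dA h
      simp only [Set.mem_inter_iff, openAt, Set.mem_ofPred_eq, h s hs] at *
      rw [this]
    rw [← measureReal_eq_cylProb p dA', ← measureReal_eq_cylProb p dA,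
      measureReal_inter_openAt_sub p hm hup s]
    field_simp
  rw [Finset.sum_congr rfl hpiv, ← Finset.sum_div, Finset.sum_sub_distrib]
  have hsum : ∑ s ∈ Λ, cylProb Λ (A ∩ openAt s) p =
      ∑ B ∈ Λ.powerset, if indicatorConfig B ∈ A then
        ((p : ℝ) ^ B.card * (1 - p) ^ (Λ \ B).card) * B.card else 0 := by
    unfold cylProb
    rw [Finset.sum_comm]
    refine Finset.sum_congr rfl fun B hB => ?_
    have hBΛ := Finset.mem_powerset.1 hB
    by_cases hBA : indicatorConfig B ∈ A
    · have : ∀ s, indicatorConfig B ∈ openAt s ↔ s ∈ B := by simp [openAt, indicatorConfig]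
      simp only [Set.mem_inter_iff, hBA, true_and, this, if_true]
      rw [← Finset.sum_filter, Finset.filter_mem_eq_inter, Finset.inter_eq_right.2 hBΛ,
        Finset.sum_const, nsmul_eq_mul, mul_comm]
    · simp [hBA]
  rw [hsum, Finset.sum_const, nsmul_eq_mul]
  unfold cylProb
  rw [Finset.mul_sum, Finset.mul_sum, ← Finset.sum_sub_distrib, Finset.sum_div]
  refine Finset.sum_congr rfl fun B _ => ?_
  split_ifs
  · ring
  · simp

lemma measure_mono_of_isUpperSet {Λ : Finset S} {A : Set (S → Bool)}
    (dA : DependsOn (· ∈ A) (Λ : Set S)) (hup : IsUpperSet A) {p q : I} (hpq : p ≤ q) :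
    measure S p A ≤ measure S q A := by
  classical
  have hmono : MonotoneOn (cylProb Λ A) (Set.Icc 0 1) := by
    have hd : ∀ x ∈ interior (Set.Icc (0 : ℝ) 1), ∃ d, 0 ≤ d ∧ HasDerivAt (cylProb Λ A) d x := by
      intro x hx
      rw [interior_Icc] at hx
      exact ⟨_, Finset.sum_nonneg fun _ _ => measureReal_nonneg,
        hasDerivAt_cylProb dA hup (p := ⟨x, hx.1.le, hx.2.le⟩) hx.1 hx.2⟩
    refine monotoneOn_of_deriv_nonneg (convex_Icc 0 1) (continuous_cylProb Λ A).continuousOn ?_ ?_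
    · intro x hx
      obtain ⟨d, -, h⟩ := hd x hx
      exact h.differentiableAt.differentiableWithinAt
    · intro x hx
      obtain ⟨d, h0, h⟩ := hd x hx
      rwa [h.deriv]
  have := hmono p.2 q.2 hpq
  rw [← measureReal_eq_cylProb p dA, ← measureReal_eq_cylProb q dA] at this
  rwa [measureReal_def, measureReal_def,
    ENNReal.toReal_le_toReal (measure_ne_top _ _) (measure_ne_top _ _)] at this

lemma measure_map_comp_equiv {T : Type*} (p : I) (e : S ≃ T) :
    (measure T p).map (fun ω => ω ∘ e) = measure S p := by
  classical
  have hm : Measurable fun ω : T → Bool => ω ∘ e :=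
    measurable_pi_lambda _ fun s => measurable_pi_apply (e s)
  refine Measure.eq_infinitePi _ fun s t ht => ?_
  rw [Measure.map_apply hm (MeasurableSet.pi s.countable_toSet fun i _ => ht i)]
  have : (fun ω : T → Bool => ω ∘ e) ⁻¹' Set.pi s t =
      Set.pi (s.map e.toEmbedding) fun i => t (e.symm i) := by
    ext ω; simp [Set.mem_pi, e.forall_congr_left]
  rw [this, measure, Measure.infinitePi_pi _ fun i _ => ht (e.symm i)]
  simp

end Measure

/-! ### Open paths -/

section Paths

variable {V : Type*} (G : SimpleGraph V)

/-- There is a path from `x` to `y` in `G` all of whose vertices after `x` are open and belong to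
`A`. The state of `x` itself is ignored, so that the relation is independent of it. -/
def Conn (ω : V → Bool) (A : Set V) (x y : V) : Prop :=
  Relation.ReflTransGen (fun a b => G.Adj a b ∧ b ∈ A ∧ ω b = true) x y

variable {G} {ω ω' : V → Bool} {A A' : Set V} {x y z : V}

lemma Conn.refl : Conn G ω A x x := Relation.ReflTransGen.refl

lemma Conn.tail (h : Conn G ω A x y) (h1 : G.Adj y z) (h2 : z ∈ A) (h3 : ω z = true) :
    Conn G ω A x z := Relation.ReflTransGen.tail h ⟨h1, h2, h3⟩

lemma Conn.head (h1 : G.Adj x y) (h2 : y ∈ A) (h3 : ω y = true) (h : Conn G ω A y z) :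
    Conn G ω A x z := Relation.ReflTransGen.head ⟨h1, h2, h3⟩ h

lemma Conn.trans (h : Conn G ω A x y) (h' : Conn G ω A y z) : Conn G ω A x z :=
  Relation.ReflTransGen.trans h h'

lemma Conn.mono (h : Conn G ω A x y) (hA : A ⊆ A') (hω : ∀ i ∈ A, ω i = true → ω' i = true) :
    Conn G ω' A' x y :=
  Relation.ReflTransGen.mono (fun _ _ h => ⟨h.1, hA h.2.1, hω _ h.2.1 h.2.2⟩) _ _ h

lemma Conn.eq_or_mem (h : Conn G ω A x y) : y = x ∨ (y ∈ A ∧ ω y = true) := by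
  rcases Relation.ReflTransGen.cases_tail h with h | ⟨_, _, h⟩
  · exact Or.inl h
  · exact Or.inr h.2

lemma Conn.mem_of_mem (h : Conn G ω A x y) (hx : x ∈ A) : y ∈ A := by
  rcases h.eq_or_mem with rfl | h
  exacts [hx, h.1]

lemma dependsOn_conn (A : Set V) (x y : V) : DependsOn (· ∈ {ω | Conn G ω A x y}) A := by
  intro ω ω' h
  refine propext ⟨fun h' => Conn.mono h' subset_rfl ?_, fun h' => Conn.mono h' subset_rfl ?_⟩
  · intro i hi; rw [h i hi]; exact id
  · intro i hi; rw [h i hi]; exact id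

/-- Loops through the starting point can be removed. -/
lemma Conn.diff_singleton (h : Conn G ω A x y) : Conn G ω (A \ {x}) x y := by
  induction h with
  | refl => exact Conn.refl
  | @tail b c _ hbc ih =>
    by_cases hc : c = x
    · rw [hc]; exact Conn.refl
    · exact ih.tail hbc.1 ⟨hbc.2.1, hc⟩ hbc.2.2

/-- A path uses only finitely many open vertices. -/
lemma conn_iff_exists_finset [DecidableEq V] :
    Conn G ω A x y ↔ ∃ F : Finset V, (∀ i ∈ F, ω i = true) ∧
      Conn G (indicatorConfig F) A x y := by
  constructor
  · intro h
    induction h with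
    | refl => exact ⟨∅, by simp, Conn.refl⟩
    | @tail b c _ hbc ih =>
      obtain ⟨F, hF, h⟩ := ih
      refine ⟨insert c F, ?_, ?_⟩
      · intro i hi
        rcases Finset.mem_insert.1 hi with rfl | hi
        exacts [hbc.2.2, hF i hi]
      · refine Conn.tail (h.mono subset_rfl fun i _ hi => ?_) hbc.1 hbc.2.1
          (by simp [indicatorConfig])
        simp only [indicatorConfig, decide_eq_true_eq] at hi ⊢
        exact Finset.mem_insert_of_mem hi
  · rintro ⟨F, hF, h⟩
    exact h.mono subset_rfl fun i _ hi => hF i (by simpa [indicatorConfig] using hi)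

/-- A path is contained in a finite set of vertices. -/
lemma conn_iff_exists_finset_subset [DecidableEq V] :
    Conn G ω Set.univ x y ↔ ∃ W : Finset V, Conn G ω W x y := by
  constructor
  · intro h
    induction h with
    | refl => exact ⟨∅, Conn.refl⟩
    | @tail b c _ hbc ih =>
      obtain ⟨W, h⟩ := ih
      refine ⟨insert c W, Conn.tail (h.mono ?_ fun i _ hi => hi) hbc.1 (by simp) hbc.2.2⟩
      simp
  · rintro ⟨W, h⟩
    exact h.mono (Set.subset_univ _) fun i _ hi => hi

lemma measurableSet_conn [Countable V] (A : Set V) (x y : V) :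
    MeasurableSet {ω | Conn G ω A x y} := by
  classical
  have : {ω | Conn G ω A x y} = ⋃ F : Finset V, ⋃ _ : Conn G (indicatorConfig F) A x y,
      ⋂ i ∈ F, openAt i := by
    ext ω
    simp only [Set.mem_ofPred_eq, Set.mem_iUnion, Set.mem_iInter, openAt, exists_prop]
    rw [conn_iff_exists_finset]
    simp only [and_comm]
  rw [this]
  exact MeasurableSet.iUnion fun F => MeasurableSet.iUnion fun _ =>
    Finset.measurableSet_biInter F fun i _ => measurableSet_openAt i

lemma conn_image_iff (γ : G ≃g G) : Conn G ω (γ '' A) (γ x) (γ y) ↔ Conn G (ω ∘ γ) A x y := by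
  constructor
  · have : ∀ {γ : G ≃g G} {ω A x y}, Conn G ω A x y →
        Conn G (ω ∘ γ) (γ ⁻¹' A) (γ.symm x) (γ.symm y) := by
      intro γ ω A x y h
      induction h with
      | refl => exact Conn.refl
      | @tail b c _ hbc ih =>
        refine ih.tail (γ.symm.map_adj_iff.2 hbc.1) ?_ ?_
        · simpa using hbc.2.1
        · simpa using hbc.2.2
    intro h
    have h' := this (γ := γ) h
    simpa [Set.preimage_image_eq _ γ.injective] using h'
  · intro h
    induction h with
    | refl => exact Conn.refl
    | @tail b c _ hbc ih =>
      exact ih.tail (γ.map_adj_iff.2 hbc.1) (Set.mem_image_of_mem _ hbc.2.1) hbc.2.2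

variable (G) in
/-- The event that `v` lies outside the finite set `S` and is adjacent to the cluster of `x` in
`S`. Neither the state of `x` nor that of `v` matters. -/
def touch (S : Finset V) (x v : V) : Set (V → Bool) :=
  {ω | v ∉ S ∧ ∃ u, Conn G ω S x u ∧ G.Adj u v}

lemma dependsOn_touch (S : Finset V) (x v : V) : DependsOn (· ∈ touch G S x v) (S : Set V) := by
  intro ω ω' h
  have : ∀ u, Conn G ω S x u ↔ Conn G ω' S x u := fun u => iff_of_eq (dependsOn_conn _ _ _ h)
  simp only [touch, Set.mem_ofPred_eq, this]

lemma measurableSet_touch (S : Finset V) (x v : V) : MeasurableSet (touch G S x v) :=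
  measurableSet_of_dependsOn_finset (dependsOn_touch S x v)

lemma isUpperSet_touch (S : Finset V) (x v : V) : IsUpperSet (touch G S x v) := by
  rintro ω ω' h ⟨hv, u, hu, huv⟩
  exact ⟨hv, u, hu.mono subset_rfl fun i _ hi => (Bool.eq_true_of_true_le (hi ▸ h i)), huv⟩

variable (G) in
/-- The expected number of vertices outside `S` adjacent to the cluster of `x` in `S`. -/
noncomputable def boundarySize (p : I) (S : Finset V) (x : V) : ENNReal :=
  ∑' v, measure V p (touch G S x v)

lemma boundarySize_mono (S : Finset V) (x : V) {p q : I} (hpq : p ≤ q) :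
    boundarySize G p S x ≤ boundarySize G q S x :=
  ENNReal.tsum_le_tsum fun v =>
    measure_mono_of_isUpperSet (dependsOn_touch S x v) (isUpperSet_touch S x v) hpq

lemma boundarySize_map (p : I) (S : Finset V) (x : V) (γ : G ≃g G) :
    boundarySize G p (S.map γ.toEquiv.toEmbedding) (γ x) = boundarySize G p S x := by
  unfold boundarySize
  rw [← γ.toEquiv.tsum_eq]
  refine tsum_congr fun v => ?_
  have hm : Measurable fun ω : V → Bool => ω ∘ γ.toEquiv :=
    measurable_pi_lambda _ fun s => measurable_pi_apply (γ.toEquiv s)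
  conv_rhs =>
    rw [← measure_map_comp_equiv p γ.toEquiv, Measure.map_apply hm (measurableSet_touch _ _ _)]
  congr 1
  ext ω
  simp only [touch, Set.mem_ofPred_eq, Set.mem_preimage]
  have hS : ((S.map γ.toEquiv.toEmbedding : Finset V) : Set V) = γ '' S := by simp
  rw [hS]
  refine and_congr ?_ ?_
  · rw [Finset.mem_map_equiv, γ.toEquiv.symm_apply_apply]
  · rw [← γ.toEquiv.exists_congr_right]
    refine exists_congr fun u => and_congr ?_ γ.map_adj_iff
    exact conn_image_iff γ

end Paths

/-! ### The subcritical regime -/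

section Subcritical

variable {V : Type*} (G : SimpleGraph V)

/-- The event that the cluster of `x` in `S` (with `x` regarded as open) is `D`. -/
def clusterEq (S : Finset V) (x : V) (D : Finset V) : Set (V → Bool) :=
  {ω | ∀ u, u ∈ D ↔ Conn G ω S x u}

variable {G}

lemma dependsOn_clusterEq (S : Finset V) (x : V) (D : Finset V) :
    DependsOn (· ∈ clusterEq G S x D) {z | z ∈ S ∧ (z ∈ D ∨ ∃ u ∈ D, G.Adj u z)} := by
  have key : ∀ ω ω' : V → Bool,
      (∀ z ∈ {z | z ∈ S ∧ (z ∈ D ∨ ∃ u ∈ D, G.Adj u z)}, ω z = ω' z) →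
      ω ∈ clusterEq G S x D → ω' ∈ clusterEq G S x D := by
    intro ω ω' h hω u
    rw [hω u]
    constructor
    · intro hu
      induction hu with
      | refl => exact Conn.refl
      | @tail b c hb hbc ih =>
        refine ih.tail hbc.1 hbc.2.1 ?_
        rw [← h c ⟨hbc.2.1, Or.inl ((hω c).2 (Relation.ReflTransGen.tail hb hbc))⟩]
        exact hbc.2.2
    · intro hu
      induction hu with
      | refl => exact Conn.refl
      | @tail b c hb hbc ih =>
        refine ih.tail hbc.1 hbc.2.1 ?_
        rw [h c ⟨hbc.2.1, Or.inr ⟨b, (hω b).2 ih, hbc.1⟩⟩]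
        exact hbc.2.2
  intro ω ω' h
  exact propext ⟨key ω ω' h, key ω' ω fun z hz => (h z hz).symm⟩

lemma measurableSet_clusterEq (S : Finset V) (x : V) (D : Finset V) :
    MeasurableSet (clusterEq G S x D) :=
  measurableSet_of_dependsOn_finset ((dependsOn_clusterEq S x D).mono fun _ hz => hz.1)

/-- A path that leaves `S` leaves the cluster `D` of its starting point in `S` for the last time
through a vertex `v` outside `S`, and from then on avoids all vertices that have to be inspected
in order to determine `D`. -/
lemma Conn.exists_last_exit {ω : V → Bool} {W : Set V} {S D : Finset V} {x y : V}
    (hω : ω ∈ clusterEq G S x D) (hx : x ∈ S) (hy : y ∉ S) (h : Conn G ω W x y) :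
    ∃ v, v ∉ S ∧ (∃ u ∈ D, G.Adj u v) ∧ ω v = true ∧
      Conn G ω (W \ {z | z ∈ S ∧ (z ∈ D ∨ ∃ u ∈ D, G.Adj u z)}) v y := by
  set K : Set V := {z | z ∈ S ∧ (z ∈ D ∨ ∃ u ∈ D, G.Adj u z)}
  have hxD : x ∈ D := (hω x).2 Conn.refl
  have hDS : ∀ u ∈ D, u ∈ S := fun u hu => ((hω u).1 hu).mem_of_mem hx
  -- A path that starts in `D` and then avoids `K` must step out of `S` at once.
  have step : ∀ a ∈ D, Conn G ω (W \ K) a y → ∃ v, v ∉ S ∧ (∃ u ∈ D, G.Adj u v) ∧ ω v = true ∧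
      Conn G ω (W \ K) v y := by
    intro a ha hay
    rcases Relation.ReflTransGen.cases_head hay with rfl | ⟨b, hab, hby⟩
    · exact absurd (hDS _ ha) hy
    · exact ⟨b, fun hb => hab.2.1.2 ⟨hb, Or.inr ⟨a, ha, hab.1⟩⟩, ⟨a, ha, hab.1⟩, hab.2.2, hby⟩
  have main : Conn G ω (W \ K) x y ∨ ∃ v, v ∉ S ∧ (∃ u ∈ D, G.Adj u v) ∧ ω v = true ∧
      Conn G ω (W \ K) v y := by
    refine Relation.ReflTransGen.head_induction_on
      (motive := fun a _ => Conn G ω (W \ K) a y ∨ ∃ v, v ∉ S ∧ (∃ u ∈ D, G.Adj u v) ∧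
        ω v = true ∧ Conn G ω (W \ K) v y) h (Or.inl Conn.refl) ?_
    rintro a b hab - (ih | ih)
    · by_cases hb : b ∈ K
      · have hbD : b ∈ D := by
          rcases hb with ⟨hbS, hbD | ⟨u, hu, hub⟩⟩
          · exact hbD
          · exact (hω b).2 (((hω u).1 hu).tail hub hbS hab.2.2)
        exact Or.inr (step b hbD ih)
      · exact Or.inl (Conn.head hab.1 ⟨hab.2.1, hb⟩ hab.2.2 ih)
    · exact Or.inr ih
  exact main.elim (step x hxD) id

variable [Countable V]

/-- The inequality of Simon and Lieb: conditioning on the cluster of `x` in `S` bounds the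
probability of a connection to a vertex outside `S`. -/
theorem measure_conn_le (p : I) (W : Set V) {S : Finset V} {x y : V} (hx : x ∈ S) (hy : y ∉ S) :
    measure V p {ω | Conn G ω W x y} ≤
      ∑' v, measure V p (touch G S x v) *
        (ENNReal.ofReal p * measure V p {ω | Conn G ω W v y}) := by
  classical
  let K : Finset V → Set V := fun D => {z | z ∈ S ∧ (z ∈ D ∨ ∃ u ∈ D, G.Adj u z)}
  let F : Finset V → V → Set (V → Bool) := fun D v =>
    openAt v ∩ {ω | Conn G ω ((W \ K D) \ {v}) v y}
  have hcover : {ω | Conn G ω W x y} ⊆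
      ⋃ v, ⋃ D ∈ S.powerset, (clusterEq G S x D ∩ touch G S x v) ∩ F D v := by
    intro ω h
    let D : Finset V := S.filter fun u => Conn G ω S x u
    have hD : ω ∈ clusterEq G S x D := by
      intro u
      simp only [D, Finset.mem_filter, and_iff_right_iff_imp]
      exact fun hu => hu.mem_of_mem hx
    obtain ⟨v, hvS, ⟨u, hu, huv⟩, hv, hvy⟩ := Conn.exists_last_exit hD hx hy h
    simp only [Set.mem_iUnion]
    exact ⟨v, D, Finset.mem_powerset.2 (Finset.filter_subset _ _),
      ⟨hD, hvS, u, (hD u).1 hu, huv⟩, hv, hvy.diff_singleton⟩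
  have hF : ∀ D v, measure V p (F D v) ≤
      ENNReal.ofReal p * measure V p {ω | Conn G ω W v y} := by
    intro D v
    have hd : DependsOn (· ∈ {ω | Conn G ω ((W \ K D) \ {v}) v y}) ({v}ᶜ : Set V) :=
      (dependsOn_conn _ _ _).mono fun z hz => hz.2
    rw [measure_inter_of_dependsOn p disjoint_compl_right (measurableSet_openAt v)
      (measurableSet_conn _ _ _) (dependsOn_openAt v) hd, measure_openAt]
    gcongr
    exact fun h => Conn.mono h (fun z hz => hz.1.1) fun _ _ h => h
  have hind : ∀ D v, measure V p ((clusterEq G S x D ∩ touch G S x v) ∩ F D v) ≤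
      measure V p (clusterEq G S x D ∩ touch G S x v) *
        (ENNReal.ofReal p * measure V p {ω | Conn G ω W v y}) := by
    intro D v
    by_cases hc : v ∉ S ∧ ∃ u ∈ D, G.Adj u v
    · have hE : clusterEq G S x D ∩ touch G S x v = clusterEq G S x D := by
        refine Set.inter_eq_left.2 fun ω hω => ?_
        obtain ⟨hv, u, hu, huv⟩ := hc
        exact ⟨hv, u, (hω u).1 hu, huv⟩
      have hdF : DependsOn (· ∈ F D v) (K D)ᶜ := by
        have h1 : DependsOn (· ∈ openAt v) (K D)ᶜ :=
          (dependsOn_openAt v).mono (by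
            rintro z rfl hz
            exact hc.1 hz.1)
        have h2 : DependsOn (· ∈ {ω | Conn G ω ((W \ K D) \ {v}) v y}) (K D)ᶜ :=
          (dependsOn_conn _ _ _).mono fun z hz => hz.1.2
        intro ω ω' h
        have e1 := h1 h
        have e2 := h2 h
        simp only [F, Set.mem_inter_iff] at e1 e2 ⊢
        rw [e1, e2]
      rw [hE, measure_inter_of_dependsOn p disjoint_compl_right (measurableSet_clusterEq S x D)
        ((measurableSet_openAt v).inter (measurableSet_conn _ _ _))
        (dependsOn_clusterEq S x D) hdF]
      gcongr
      exact hF D v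
    · have hE : clusterEq G S x D ∩ touch G S x v = ∅ := by
        refine Set.eq_empty_of_forall_notMem ?_
        rintro ω ⟨hω, hv, u, hu, huv⟩
        exact hc ⟨hv, u, (hω u).2 hu, huv⟩
      simp [hE]
  have hdisj : ∀ v, ∑ D ∈ S.powerset, measure V p (clusterEq G S x D ∩ touch G S x v) ≤
      measure V p (touch G S x v) := by
    intro v
    rw [← measure_biUnion_finset]
    · exact measure_mono (Set.iUnion₂_subset fun D _ => Set.inter_subset_right)
    · intro D _ D' _ hne
      refine Set.disjoint_left.2 fun ω h h' => hne ?_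
      ext u
      rw [h.1 u, h'.1 u]
    · exact fun D _ => (measurableSet_clusterEq S x D).inter (measurableSet_touch S x v)
  calc measure V p {ω | Conn G ω W x y}
      ≤ ∑' v, ∑ D ∈ S.powerset,
          measure V p ((clusterEq G S x D ∩ touch G S x v) ∩ F D v) :=
        (measure_mono hcover).trans <| (measure_iUnion_le _).trans <|
          ENNReal.tsum_le_tsum fun v => measure_biUnion_finset_le _ _
    _ ≤ _ := by
        refine ENNReal.tsum_le_tsum fun v => ?_
        calc _ ≤ ∑ D ∈ S.powerset, measure V p (clusterEq G S x D ∩ touch G S x v) *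
              (ENNReal.ofReal p * measure V p {ω | Conn G ω W v y}) :=
              Finset.sum_le_sum fun D _ => hind D v
          _ ≤ _ := by
              rw [← Finset.sum_mul]
              gcongr
              exact hdisj v

/-- If every vertex has a bounded neighbourhood `S` with `p * boundarySize G p S x ≤ c < 1`, then
the expected cluster sizes are bounded. -/
theorem tsum_measure_conn_le {p : I} {c : ENNReal} (hc : c < 1) {M : ℕ}
    (h : ∀ x : V, ∃ S : Finset V, x ∈ S ∧ S.card ≤ M ∧
      ENNReal.ofReal p * boundarySize G p S x ≤ c) (x : V) :
    ∑' y, measure V p {ω | Conn G ω Set.univ x y} ≤ M / (1 - c) := by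
  classical
  let a : Finset V → V → ENNReal := fun W x => ∑ y ∈ W, measure V p {ω | Conn G ω W x y}
  have ha : ∀ W x, a W x ≤ M / (1 - c) := by
    intro W
    set A : ENNReal := ⨆ v, a W v
    -- Truncating to the finite set `W` makes `A` finite, so that `A ≤ M + c * A` can be solved.
    have hA : A ≤ W.card := by
      refine iSup_le fun v => ?_
      calc a W v ≤ ∑ y ∈ W, 1 := Finset.sum_le_sum fun _ _ => prob_le_one
        _ = W.card := by simp
    have hAtop : A ≠ ⊤ := ne_top_of_le_ne_top (ENNReal.natCast_ne_top _) hA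
    have hrec : ∀ x, a W x ≤ M + c * A := by
      intro x
      obtain ⟨S, hxS, hSM, hS⟩ := h x
      calc a W x = ∑ y ∈ W ∩ S, measure V p {ω | Conn G ω W x y} +
            ∑ y ∈ W \ S, measure V p {ω | Conn G ω W x y} :=
            (Finset.sum_inter_add_sum_sdiff W S _).symm
        _ ≤ ∑ y ∈ S, 1 + ∑ y ∈ W \ S, ∑' v, measure V p (touch G S x v) *
              (ENNReal.ofReal p * measure V p {ω | Conn G ω W v y}) := by
            refine add_le_add ?_ ?_
            · exact (Finset.sum_le_sum fun _ _ => prob_le_one).trans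
                (Finset.sum_le_sum_of_subset Finset.inter_subset_right)
            · exact Finset.sum_le_sum fun y hy =>
                measure_conn_le p W hxS (Finset.mem_sdiff.1 hy).2
        _ ≤ M + c * A := by
            refine add_le_add (by simpa using hSM) ?_
            rw [← Summable.tsum_finsetSum fun _ _ => ENNReal.summable]
            calc ∑' v, ∑ y ∈ W \ S, measure V p (touch G S x v) *
                  (ENNReal.ofReal p * measure V p {ω | Conn G ω W v y})
                ≤ ∑' v, measure V p (touch G S x v) * (ENNReal.ofReal p * A) := by
                  refine ENNReal.tsum_le_tsum fun v => ?_
                  rw [← Finset.mul_sum, ← Finset.mul_sum]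
                  gcongr
                  exact (Finset.sum_le_sum_of_subset Finset.sdiff_subset).trans
                    (le_iSup (a W) v)
              _ = ENNReal.ofReal p * boundarySize G p S x * A := by
                  rw [ENNReal.tsum_mul_right, boundarySize]; ring
              _ ≤ c * A := by gcongr
    have hfin : A ≤ M + c * A := iSup_le hrec
    have hcA : c * A ≠ ⊤ := ENNReal.mul_ne_top (ne_top_of_lt hc) hAtop
    have : A * (1 - c) ≤ M := by
      rw [ENNReal.mul_sub (fun _ _ => hAtop), mul_one, mul_comm]
      exact tsub_le_iff_right.2 hfin
    intro x
    refine (le_iSup (a W) x).trans ?_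
    rw [ENNReal.le_div_iff_mul_le (Or.inl (tsub_pos_of_lt hc).ne')
      (Or.inl (ne_top_of_le_ne_top ENNReal.one_ne_top tsub_le_self))]
    exact this
  have hmono : ∀ y, Monotone fun W : Finset V => measure V p {ω | Conn G ω W x y} :=
    fun y W W' hW => measure_mono fun ω h => h.mono (Finset.coe_subset.2 hW) fun _ _ h => h
  have hsup : ∀ y, measure V p {ω | Conn G ω Set.univ x y} =
      ⨆ W : Finset V, measure V p {ω | Conn G ω W x y} := by
    intro y
    have : {ω | Conn G ω Set.univ x y} = ⋃ W : Finset V, {ω | Conn G ω W x y} := by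
      ext ω
      simp only [Set.mem_ofPred_eq, Set.mem_iUnion]
      exact conn_iff_exists_finset_subset
    rw [this, Directed.measure_iUnion]
    refine Monotone.directed_le fun W W' hW ω h => ?_
    exact Conn.mono h (Finset.coe_subset.2 hW) fun _ _ h => h
  rw [ENNReal.tsum_eq_iSup_sum]
  refine iSup_le fun Y => ?_
  simp_rw [hsup]
  rw [ENNReal.finsetSum_iSup_of_monotone hmono]
  refine iSup_le fun W => ?_
  calc ∑ y ∈ Y, measure V p {ω | Conn G ω W x y}
      ≤ ∑ y ∈ W ∪ Y, measure V p {ω | Conn G ω (W ∪ Y : Finset V) x y} := by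
        refine (Finset.sum_le_sum_of_subset (Finset.subset_union_right (s₁ := W))).trans ?_
        exact Finset.sum_le_sum fun y _ => hmono y Finset.subset_union_left
    _ ≤ _ := ha (W ∪ Y) x

end Subcritical

/-! ### The supercritical regime -/

section Supercritical

variable {V : Type*} (G : SimpleGraph V)

/-- The event that the cluster of `x` in `Λ` (with `x` regarded as open) is adjacent to a vertex
outside `Λ`. -/
def exits (Λ : Finset V) (x : V) : Set (V → Bool) :=
  {ω | ∃ u w, Conn G ω Λ x u ∧ G.Adj u w ∧ w ∉ Λ}

/-- The event that `S` is the set of vertices of `Λ` from which one cannot exit `Λ`. -/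
def trappedEq (Λ S : Finset V) : Set (V → Bool) :=
  {ω | ∀ z, z ∈ S ↔ z ∈ Λ ∧ ω ∉ exits G Λ z}

variable {G} {Λ S : Finset V} {x y v : V} {ω : V → Bool}

lemma dependsOn_exits (Λ : Finset V) (x : V) : DependsOn (· ∈ exits G Λ x) (Λ : Set V) := by
  intro ω ω' h
  have : ∀ u, Conn G ω Λ x u ↔ Conn G ω' Λ x u := fun u => iff_of_eq (dependsOn_conn _ _ _ h)
  simp only [exits, Set.mem_ofPred_eq, this]

lemma isUpperSet_exits (Λ : Finset V) (x : V) : IsUpperSet (exits G Λ x) := by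
  rintro ω ω' h ⟨u, w, hu, huw, hw⟩
  exact ⟨u, w, hu.mono subset_rfl fun i _ hi => (Bool.eq_true_of_true_le (hi ▸ h i)), huw, hw⟩

lemma exits_of_adj (h : G.Adj x y) (hy : y ∉ Λ) : ω ∈ exits G Λ x := ⟨x, y, Conn.refl, h, hy⟩

lemma exits_of_conn (hxy : Conn G ω Λ x y) (h : ω ∈ exits G Λ y) : ω ∈ exits G Λ x := by
  obtain ⟨u, w, hu, huw, hw⟩ := h
  exact ⟨u, w, hxy.trans hu, huw, hw⟩

lemma exits_of_step (h1 : G.Adj x y) (h2 : y ∈ Λ) (h3 : ω y = true) (h : ω ∈ exits G Λ y) :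
    ω ∈ exits G Λ x :=
  exits_of_conn (Conn.head h1 h2 h3 Conn.refl) h

lemma exits_induction {P : V → Prop} (h : ω ∈ exits G Λ x)
    (base : ∀ u w, G.Adj u w → w ∉ Λ → P u)
    (step : ∀ a b, G.Adj a b → b ∈ Λ → ω b = true → ω ∈ exits G Λ b → P b → P a) : P x := by
  obtain ⟨u, w, hu, huw, hw⟩ := h
  refine Relation.ReflTransGen.head_induction_on (motive := fun a _ => P a) hu
    (base u w huw hw) ?_
  intro a b hab hbu hP
  exact step a b hab.1 hab.2.1 hab.2.2 (exits_of_conn hbu ⟨u, w, Conn.refl, huw, hw⟩) hP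

/-- The set of trapped vertices is determined by the states of the vertices that are not trapped:
these are all that an exploration from the outside of `Λ` ever inspects. -/
lemma dependsOn_trappedEq (Λ S : Finset V) :
    DependsOn (· ∈ trappedEq G Λ S) (S : Set V)ᶜ := by
  have key : ∀ ω ω' : V → Bool, (∀ z ∈ (S : Set V)ᶜ, ω z = ω' z) →
      ω ∈ trappedEq G Λ S → ω' ∈ trappedEq G Λ S := by
    intro ω ω' h hω
    have hb : ∀ b ∈ Λ, ω ∈ exits G Λ b → ω b = ω' b := fun b hbΛ hb =>
      h b fun hbS => ((hω b).1 hbS).2 hb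
    have h1 : ∀ z, ω' ∈ exits G Λ z → ω ∈ exits G Λ z := fun z hz =>
      exits_induction (P := fun z => ω ∈ exits G Λ z) hz (fun u w => exits_of_adj)
        fun a b hab hbΛ hb' _ ih =>
        exits_of_step hab hbΛ ((hb b hbΛ ih).trans hb') ih
    have h2 : ∀ z, ω ∈ exits G Λ z → ω' ∈ exits G Λ z := fun z hz =>
      exits_induction (P := fun z => ω' ∈ exits G Λ z) hz (fun u w => exits_of_adj)
        fun a b hab hbΛ hb' hbe ih =>
        exits_of_step hab hbΛ ((hb b hbΛ hbe).symm.trans hb') ih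
    intro z
    rw [hω z, not_congr ⟨h2 z, h1 z⟩]
  intro ω ω' h
  exact propext ⟨key ω ω' h, key ω' ω fun z hz => (h z hz).symm⟩

lemma measurableSet_trappedEq (Λ S : Finset V) : MeasurableSet (trappedEq G Λ S) := by
  refine measurableSet_of_dependsOn_finset (Λ := Λ) ?_
  intro ω ω' h
  have : ∀ z, ω ∈ exits G Λ z ↔ ω' ∈ exits G Λ z := fun z => iff_of_eq (dependsOn_exits Λ z h)
  simp only [trappedEq, Set.mem_ofPred_eq, this]

/-- A vertex adjacent to the cluster of `x` inside the set of trapped vertices is pivotal for the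
event that `x` exits `Λ`. -/
lemma trappedEq_inter_touch_subset [DecidableEq V] (hx : x ∈ S) :
    trappedEq G Λ S ∩ touch G S x v ⊆ {ω | v ∈ Λ ∧ ω ∈ pivotal (exits G Λ x) v} := by
  rintro ω ⟨hω, hvS, u, hu, huv⟩
  have huS : u ∈ S := hu.mem_of_mem hx
  have hvΛ : v ∈ Λ := by
    by_contra hv
    exact ((hω u).1 huS).2 (exits_of_adj huv hv)
  have hve : ω ∈ exits G Λ v := by
    by_contra h
    exact hvS ((hω v).2 ⟨hvΛ, h⟩)
  have hvc : ω v = false := by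
    by_contra h
    exact ((hω u).1 huS).2 (exits_of_step huv hvΛ (by simpa using h) hve)
  have hle : ω ≤ Function.update ω v true := by
    intro i
    by_cases hi : i = v
    · subst hi; simp
    · simp [hi]
  refine ⟨hvΛ, ?_, ?_⟩
  · have hu' : Conn G (Function.update ω v true) Λ x u :=
      hu.mono (fun z hz => ((hω z).1 hz).1) fun i _ hi => Bool.eq_true_of_true_le (hi ▸ hle i)
    exact exits_of_conn hu' (exits_of_step huv hvΛ (by simp) (isUpperSet_exits Λ v hle hve))
  · rw [← hvc, Function.update_eq_self]
    exact ((hω x).1 hx).2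

/-- If `boundarySize G p S x ≥ 1` for all finite `S`, then the expected number of vertices that
are pivotal for the event that `x` exits `Λ` is at least the probability of the complement. -/
theorem measure_compl_exits_le [DecidableEq V] {p : I} {x : V}
    (h : ∀ S : Finset V, x ∈ S → 1 ≤ boundarySize G p S x) {Λ : Finset V} (hx : x ∈ Λ) :
    measure V p (exits G Λ x)ᶜ ≤ ∑ v ∈ Λ, measure V p (pivotal (exits G Λ x) v) := by
  classical
  let 𝒮 : Finset (Finset V) := Λ.powerset.filter (x ∈ ·)
  have hcover : (exits G Λ x)ᶜ ⊆ ⋃ S ∈ 𝒮, trappedEq G Λ S := by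
    intro ω hω
    simp only [Set.mem_iUnion]
    refine ⟨Λ.filter fun z => ω ∉ exits G Λ z, ?_, ?_⟩
    · simp only [𝒮, Finset.mem_filter, Finset.mem_powerset, Finset.filter_subset, true_and]
      exact ⟨hx, hω⟩
    · intro z; simp
  have hSx : ∀ S ∈ 𝒮, x ∈ S := fun S hS => (Finset.mem_filter.1 hS).2
  have hterm : ∀ S ∈ 𝒮, measure V p (trappedEq G Λ S) ≤
      ∑ v ∈ Λ, measure V p (trappedEq G Λ S ∩ touch G S x v) := by
    intro S hS
    have hzero : ∀ v ∉ Λ, measure V p (trappedEq G Λ S ∩ touch G S x v) = 0 := by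
      intro v hv
      have : trappedEq G Λ S ∩ touch G S x v = ∅ := Set.eq_empty_of_forall_notMem fun ω hω =>
        hv (trappedEq_inter_touch_subset (hSx S hS) hω).1
      rw [this, measure_empty]
    rw [← tsum_eq_sum (L := SummationFilter.unconditional V) hzero]
    calc measure V p (trappedEq G Λ S)
        ≤ measure V p (trappedEq G Λ S) * boundarySize G p S x :=
          le_mul_of_one_le_right' (h S (hSx S hS))
      _ = _ := by
          rw [boundarySize, ← ENNReal.tsum_mul_left]
          exact tsum_congr fun v => (measure_inter_of_dependsOn p disjoint_compl_left
            (measurableSet_trappedEq Λ S) (measurableSet_touch S x v)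
            (dependsOn_trappedEq Λ S) (dependsOn_touch S x v)).symm
  calc measure V p (exits G Λ x)ᶜ ≤ ∑ S ∈ 𝒮, measure V p (trappedEq G Λ S) :=
        (measure_mono hcover).trans (measure_biUnion_finset_le _ _)
    _ ≤ ∑ S ∈ 𝒮, ∑ v ∈ Λ, measure V p (trappedEq G Λ S ∩ touch G S x v) :=
        Finset.sum_le_sum hterm
    _ = ∑ v ∈ Λ, ∑ S ∈ 𝒮, measure V p (trappedEq G Λ S ∩ touch G S x v) := Finset.sum_comm
    _ ≤ _ := by
        refine Finset.sum_le_sum fun v _ => ?_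
        rw [← measure_biUnion_finset]
        · exact measure_mono (Set.iUnion₂_subset fun S hS ω hω =>
            (trappedEq_inter_touch_subset (hSx S hS) hω).2)
        · intro D _ D' _ hne
          refine Set.disjoint_left.2 fun ω h h' => hne ?_
          ext u
          rw [h.1 u, h'.1 u]
        · exact fun S _ => (measurableSet_trappedEq Λ S).inter (measurableSet_touch S x v)

/-- Integrating the differential inequality `g' ≥ 1 - g` for the probability `g` of exiting. -/
theorem measure_compl_exits_le_exp {p q : I} (hpq : p ≤ q) {x : V}
    (h : ∀ S : Finset V, x ∈ S → 1 ≤ boundarySize G p S x) {Λ : Finset V} (hx : x ∈ Λ) :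
    measure V q (exits G Λ x)ᶜ ≤ ENNReal.ofReal (Real.exp (-(q - p))) := by
  classical
  have dA := dependsOn_exits (G := G) Λ x
  have hm := measurableSet_of_dependsOn_finset dA
  set g := cylProb Λ (exits G Λ x) with hg
  have hd : ∀ r ∈ interior (Set.Icc (p : ℝ) q), ∃ d, 1 - g r ≤ d ∧ HasDerivAt g d r := by
    intro r hr
    rw [interior_Icc] at hr
    have hr0 : 0 < r := p.2.1.trans_lt hr.1
    have hr1 : r < 1 := hr.2.trans_le q.2.2
    let r' : I := ⟨r, hr0.le, hr1.le⟩
    refine ⟨_, ?_, hasDerivAt_cylProb dA (isUpperSet_exits Λ x) (p := r') hr0 hr1⟩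
    have hmain := measure_compl_exits_le (p := r') (x := x)
      (fun S hS => (h S hS).trans (boundarySize_mono S x (show p ≤ r' from hr.1.le))) hx
    have h1 : 1 - g r = (measure V r').real (exits G Λ x)ᶜ := by
      rw [probReal_compl_eq_one_sub hm, measureReal_eq_cylProb r' dA]
    rw [h1, measureReal_def]
    calc _ ≤ (∑ v ∈ Λ, measure V r' (pivotal (exits G Λ x) v)).toReal :=
          ENNReal.toReal_mono (ENNReal.sum_ne_top.2 fun _ _ => measure_ne_top _ _) hmain
      _ = _ := ENNReal.toReal_sum fun _ _ => measure_ne_top _ _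
  have hanti : AntitoneOn (fun r => (1 - g r) * Real.exp r) (Set.Icc (p : ℝ) q) := by
    have hd' : ∀ r ∈ interior (Set.Icc (p : ℝ) q), ∃ d ≤ 0,
        HasDerivAt (fun r => (1 - g r) * Real.exp r) d r := by
      intro r hr
      obtain ⟨d, hd1, hd2⟩ := hd r hr
      refine ⟨_, ?_, (hd2.const_sub 1).mul (Real.hasDerivAt_exp r)⟩
      nlinarith [Real.exp_pos r]
    refine antitoneOn_of_deriv_nonpos (convex_Icc _ _) ?_ ?_ ?_
    · exact ((continuous_const.sub (continuous_cylProb Λ _)).mul Real.continuous_exp).continuousOn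
    · intro r hr
      obtain ⟨d, -, hd⟩ := hd' r hr
      exact hd.differentiableAt.differentiableWithinAt
    · intro r hr
      obtain ⟨d, h0, hd⟩ := hd' r hr
      rwa [hd.deriv]
  have hpq' : (p : ℝ) ≤ q := hpq
  have hfin := hanti (Set.left_mem_Icc.2 hpq') (Set.right_mem_Icc.2 hpq') hpq'
  have hgp : 0 ≤ g p := by rw [hg, ← measureReal_eq_cylProb p dA]; exact measureReal_nonneg
  have hgq : (measure V q).real (exits G Λ x)ᶜ = 1 - g q := by
    rw [probReal_compl_eq_one_sub hm, measureReal_eq_cylProb q dA]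
  rw [← ofReal_measureReal, hgq]
  refine ENNReal.ofReal_le_ofReal ?_
  have e1 : Real.exp (-((q : ℝ) - p)) = Real.exp p / Real.exp q := by
    rw [← Real.exp_sub]; ring_nf
  rw [e1, le_div_iff₀ (Real.exp_pos _)]
  refine hfin.trans ?_
  nlinarith [Real.exp_pos (p : ℝ)]

/-- If `boundarySize G p S x ≥ 1` for all finite `S`, then above `p` the cluster of `x` (with `x`
regarded as open) is infinite with positive probability. -/
theorem measure_infinite_conn_ne_zero [Countable V] (hfin : ∀ v, (G.neighborSet v).Finite) {p q : I}
    (hpq : p < q) {x : V} (h : ∀ S : Finset V, x ∈ S → 1 ≤ boundarySize G p S x) :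
    measure V q {ω | {y | Conn G ω Set.univ x y}.Infinite} ≠ 0 := by
  classical
  -- The clusters all of whose neighbours lie in `Λ`.
  let F : Finset V → Set (V → Bool) := fun Λ =>
    {ω | x ∈ Λ ∧ ∀ u, Conn G ω Set.univ x u → ∀ w, G.Adj u w → w ∈ Λ}
  have hF : ∀ Λ, measure V q (F Λ) ≤ ENNReal.ofReal (Real.exp (-(q - p))) := by
    intro Λ
    by_cases hx : x ∈ Λ
    · refine (measure_mono ?_).trans (measure_compl_exits_le_exp hpq.le h hx)
      rintro ω ⟨-, hω⟩ ⟨u, w, hu, huw, hw⟩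
      exact hw (hω u (hu.mono (Set.subset_univ _) fun _ _ h => h) w huw)
    · have : F Λ = ∅ := Set.eq_empty_of_forall_notMem fun ω hω => hx hω.1
      simp [this]
  have hU : measure V q (⋃ Λ, F Λ) ≤ ENNReal.ofReal (Real.exp (-(q - p))) := by
    rw [Directed.measure_iUnion]
    · exact iSup_le hF
    · refine Monotone.directed_le fun Λ Λ' hΛ ω hω => ?_
      exact ⟨hΛ hω.1, fun u hu w huw => hΛ (hω.2 u hu w huw)⟩
  have hcover : (Set.univ : Set (V → Bool)) ⊆
      (⋃ Λ, F Λ) ∪ {ω | {y | Conn G ω Set.univ x y}.Infinite} := by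
    intro ω _
    by_cases hω : {y | Conn G ω Set.univ x y}.Finite
    · left
      have hN : (⋃ u ∈ {y | Conn G ω Set.univ x y}, G.neighborSet u).Finite :=
        hω.biUnion fun u _ => hfin u
      simp only [Set.mem_iUnion]
      refine ⟨insert x hN.toFinset, by simp, fun u hu w huw => Finset.mem_insert_of_mem ?_⟩
      rw [Set.Finite.mem_toFinset]
      exact Set.mem_biUnion (show u ∈ {y | Conn G ω Set.univ x y} from hu) huw
    · exact Or.inr hω
  intro h0
  have h1 : (1 : ENNReal) ≤ ENNReal.ofReal (Real.exp (-(q - p))) := by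
    calc (1 : ENNReal) = measure V q Set.univ := measure_univ.symm
      _ ≤ _ := (measure_mono hcover).trans (measure_union_le _ _)
      _ ≤ _ := by rw [h0, add_zero]; exact hU
  rw [ENNReal.one_le_ofReal, Real.one_le_exp_iff] at h1
  have : (p : ℝ) < q := hpq
  linarith

end Supercritical

/-! ### Critical points and the passage to `pT` and `pH` -/

section Sharp

variable {S V : Type*}

/-- `pc` separates the parameters for which all expected cluster sizes are finite from those for
which all clusters are infinite with positive probability. -/
structure IsSharp (C : (S → Bool) → V → Set V) (pc : ℝ) : Prop where
  nonneg : 0 ≤ pc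
  le_one : pc ≤ 1
  expectedSize_lt_top : ∀ p : I, (p : ℝ) < pc → ∀ x, expectedSize C p x < ⊤
  measure_infinite_ne_zero : ∀ p : I, pc < p → ∀ x, measure S p {ω | (C ω x).Infinite} ≠ 0

lemma sSup_eq_of_threshold {P : I → Prop} {pc : ℝ} (h0 : 0 ≤ pc) (h1 : pc ≤ 1)
    (hlt : ∀ p : I, (p : ℝ) < pc → P p) (hgt : ∀ p : I, pc < p → ¬ P p) :
    sSup {q : ℝ | ∃ p : I, (p : ℝ) = q ∧ P p} = pc := by
  apply le_antisymm
  · refine Real.sSup_le ?_ h0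
    rintro _ ⟨p, rfl, hp⟩
    exact not_lt.1 fun h => hgt p h hp
  · refine le_of_forall_lt fun c hc => ?_
    obtain ⟨d, hcd, hd⟩ := exists_between hc
    refine hcd.trans_le ?_
    rcases lt_or_ge d 0 with hd0 | hd0
    · refine hd0.le.trans (Real.sSup_nonneg ?_)
      rintro _ ⟨p, rfl, -⟩
      exact p.2.1
    · refine le_csSup ⟨1, ?_⟩ ⟨⟨d, hd0, (hd.le.trans h1)⟩, rfl, hlt _ hd⟩
      rintro _ ⟨p, rfl, -⟩
      exact p.2.2

variable {C : (S → Bool) → V → Set V}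

lemma encard_eq_tsum (A : Set V) :
    ((A.encard : ℕ∞) : ENNReal) = ∑' y, A.indicator (fun _ => (1 : ENNReal)) y := by
  rw [← tsum_subtype, ENNReal.tsum_set_one]

lemma indicator_cluster_eq (x y : V) :
    (fun ω => (C ω x).indicator (fun _ => (1 : ENNReal)) y) =
      Set.indicator {ω | y ∈ C ω x} fun _ => 1 := by
  classical
  ext ω
  simp [Set.indicator_apply]

variable [Countable V]

lemma measurable_encard (hC : ∀ x y, MeasurableSet {ω | y ∈ C ω x}) (x : V) :
    Measurable fun ω => ((C ω x).encard : ENNReal) := by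
  simp_rw [encard_eq_tsum]
  refine Measurable.tsum fun y => ?_
  rw [indicator_cluster_eq]
  exact measurable_const.indicator (hC x y)

lemma expectedSize_eq_tsum (hC : ∀ x y, MeasurableSet {ω | y ∈ C ω x}) (p : I) (x : V) :
    expectedSize C p x = ∑' y, measure S p {ω | y ∈ C ω x} := by
  unfold expectedSize
  simp_rw [encard_eq_tsum]
  rw [lintegral_tsum]
  · refine tsum_congr fun y => ?_
    rw [indicator_cluster_eq, lintegral_indicator_const (hC x y), one_mul]
  · intro y
    rw [indicator_cluster_eq]
    exact (measurable_const.indicator (hC x y)).aemeasurable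

lemma measurableSet_infinite (hC : ∀ x y, MeasurableSet {ω | y ∈ C ω x}) (x : V) :
    MeasurableSet {ω | (C ω x).Infinite} := by
  have : {ω | (C ω x).Infinite} = (fun ω => ((C ω x).encard : ENNReal)) ⁻¹' {⊤} := by
    ext ω
    simp
  rw [this]
  exact measurable_encard hC x (measurableSet_singleton _)

lemma ae_finite_of_expectedSize_lt_top (hC : ∀ x y, MeasurableSet {ω | y ∈ C ω x}) {p : I} {x : V}
    (h : expectedSize C p x < ⊤) : ∀ᵐ ω ∂(measure S p), (C ω x).Finite := by
  filter_upwards [ae_lt_top (measurable_encard hC x) h.ne] with ω hω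
  simpa using hω

/-- If `C` has a sharp phase transition at `pc`, then `pT` and `pH` both equal `pc`. -/
lemma IsSharp.conclusion {pc : ℝ} (h : IsSharp C pc)
    (hC : ∀ x y, MeasurableSet {ω | y ∈ C ω x}) :
    (∀ x y : V, pT C x = pH C y) ∧
      ∀ (p : I) (x : V), (p : ℝ) < pH C x →
        (∀ᵐ ω ∂(measure S p), ∀ y : V, (C ω y).Finite) ∧ ∀ y : V, expectedSize C p y < ⊤ := by
  have hzero : ∀ (p : I) (x : V), expectedSize C p x < ⊤ →
      measure S p {ω | (C ω x).Infinite} = 0 := fun p x hp =>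
    ae_iff.1 (ae_finite_of_expectedSize_lt_top hC hp)
  have hT : ∀ x, pT C x = pc := fun x =>
    sSup_eq_of_threshold h.nonneg h.le_one (fun p hp => h.expectedSize_lt_top p hp x)
      fun p hp h' => h.measure_infinite_ne_zero p hp x (hzero p x h')
  have hH : ∀ x, pH C x = pc := fun x =>
    sSup_eq_of_threshold h.nonneg h.le_one
      (fun p hp => hzero p x (h.expectedSize_lt_top p hp x))
      fun p hp => h.measure_infinite_ne_zero p hp x
  refine ⟨fun x y => (hT x).trans (hH y).symm, fun p x hp => ?_⟩
  rw [hH x] at hp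
  exact ⟨ae_all_iff.2 fun y =>
    ae_finite_of_expectedSize_lt_top hC (h.expectedSize_lt_top p hp y),
    h.expectedSize_lt_top p hp⟩

end Sharp

/-! ### Site percolation -/

section Site

variable {V : Type*} {G : SimpleGraph V}

lemma mem_siteCluster_iff {ω : V → Bool} {x y : V} :
    y ∈ siteCluster G ω x ↔ ω x = true ∧ Conn G ω Set.univ x y := by
  constructor
  · rintro ⟨hx, hy, h⟩
    refine ⟨hx, ?_⟩
    rw [SimpleGraph.reachable_iff_reflTransGen] at h
    have := Relation.ReflTransGen.lift (p := fun a b => G.Adj a b ∧ b ∈ Set.univ ∧ ω b = true)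
      Subtype.val (fun a b hab => ⟨hab, Set.mem_univ _, b.2⟩) _ _ h
    exact this
  · rintro ⟨hx, h⟩
    induction h with
    | refl => exact ⟨hx, hx, SimpleGraph.Reachable.refl _⟩
    | @tail b c _ hbc ih =>
      obtain ⟨hx, hb, h⟩ := ih
      refine ⟨hx, hbc.2.2, h.trans (SimpleGraph.Adj.reachable ?_)⟩
      exact hbc.1

lemma measurableSet_mem_siteCluster [Countable V] (x y : V) :
    MeasurableSet {ω | y ∈ siteCluster G ω x} := by
  simp_rw [mem_siteCluster_iff]
  exact (measurableSet_openAt x).inter (measurableSet_conn _ x y)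

lemma siteCluster_mono {ω ω' : V → Bool} (h : ω ≤ ω') (x : V) :
    siteCluster G ω x ⊆ siteCluster G ω' x := by
  intro y hy
  rw [mem_siteCluster_iff] at hy ⊢
  have h' : ∀ i, ω i = true → ω' i = true := fun i hi => Bool.eq_true_of_true_le (hi ▸ h i)
  exact ⟨h' x hy.1, hy.2.mono subset_rfl fun i _ => h' i⟩

/-- Insertion tolerance: an increasing event that has positive probability still has positive
probability together with `s` being open. -/
lemma measure_openAt_inter_ne_zero {S : Type*} {p : I} (hp : 0 < (p : ℝ)) {A : Set (S → Bool)}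
    (hA : MeasurableSet A) (hup : IsUpperSet A) (h : measure S p A ≠ 0) (s : S) :
    measure S p (openAt s ∩ A) ≠ 0 := by
  classical
  have hle : A ⊆ {ω | Function.update ω s true ∈ A} := by
    intro ω hω
    refine hup ?_ hω
    intro i
    by_cases hi : i = s
    · subst hi; simp
    · simp [hi]
  have heq : openAt s ∩ A = openAt s ∩ {ω | Function.update ω s true ∈ A} := by
    ext ω
    refine and_congr_right fun h => ?_
    have h : ω s = true := h
    simp only [Set.mem_ofPred_eq]
    rw [← h, Function.update_eq_self]
  rw [heq, measure_inter_of_dependsOn p disjoint_compl_right (measurableSet_openAt s)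
    (measurableSet_update hA s true) (dependsOn_openAt s) (dependsOn_update A s true),
    measure_openAt]
  refine mul_ne_zero (by simpa using hp) fun h0 => h (measure_mono_null hle h0)

lemma isUpperSet_infinite_siteCluster (x : V) :
    IsUpperSet {ω | (siteCluster G ω x).Infinite} :=
  fun _ _ h hω => Set.Infinite.mono (siteCluster_mono h x) hω

/-- In a connected graph, if some cluster is infinite with positive probability, then all are. -/
lemma measure_infinite_siteCluster_ne_zero [Countable V] (hconn : G.Connected) {p : I}
    (hp : 0 < (p : ℝ)) {x : V} (hx : measure V p {ω | (siteCluster G ω x).Infinite} ≠ 0) (y : V) :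
    measure V p {ω | (siteCluster G ω y).Infinite} ≠ 0 := by
  have h := hconn.preconnected x y
  rw [SimpleGraph.reachable_iff_reflTransGen] at h
  induction h with
  | refl => exact hx
  | @tail b c _ hbc ih =>
    have := measure_openAt_inter_ne_zero hp
      (measurableSet_infinite measurableSet_mem_siteCluster b)
      (isUpperSet_infinite_siteCluster b) ih c
    refine fun h0 => this (measure_mono_null ?_ h0)
    rintro ω ⟨hc, hb⟩
    refine Set.Infinite.mono ?_ hb
    intro z hz
    rw [mem_siteCluster_iff] at hz ⊢
    exact ⟨hc, Conn.head hbc.symm (Set.mem_univ _) hz.1 hz.2⟩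

/-- If some vertex has infinitely many neighbours, then the critical point is `0`. -/
theorem isSharp_siteCluster_zero [Countable V] (hconn : G.Connected) {v : V}
    (hv : (G.neighborSet v).Infinite) : IsSharp (siteCluster G) 0 := by
  refine ⟨le_rfl, zero_le_one, fun p hp => absurd p.2.1 (not_le.2 hp), fun p hp x => ?_⟩
  refine measure_infinite_siteCluster_ne_zero hconn hp (x := v) ?_ x
  let f : ℕ ↪ G.neighborSet v := hv.natEmbedding
  have hfinj : Function.Injective fun n => (f n : V) :=
    Subtype.val_injective.comp f.injective
  have hind : iIndepSet (fun n => openAt (f n : V)) (measure V p) := by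
    rw [iIndepSet_iff_meas_biInter fun n => measurableSet_openAt _]
    intro s
    exact ((iIndepFun_eval p).precomp hfinj).measure_inter_preimage_eq_mul s
      (sets := fun _ => {true}) fun _ _ => measurableSet_singleton true
  have hsum : ∑' n, measure V p (openAt (f n : V)) = ⊤ := by
    simp_rw [measure_openAt]
    exact ENNReal.tsum_const_eq_top_of_ne_zero (by simpa using hp)
  have h1 := measure_limsup_eq_one (fun n => measurableSet_openAt _) hind hsum
  set A : Set (V → Bool) := Filter.limsup (fun n => openAt (f n : V)) Filter.atTop
  have hA : ∀ ω, ω ∈ A ↔ {n | ω (f n) = true}.Infinite := fun ω => by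
    rw [← Nat.frequently_atTop_iff_infinite]
    exact Filter.mem_limsup_iff_frequently_mem
  have hup : IsUpperSet A := by
    intro ω ω' h hω
    rw [hA] at hω ⊢
    exact hω.mono fun n hn => Bool.eq_true_of_true_le (le_of_eq_of_le hn.symm (h _))
  have := measure_openAt_inter_ne_zero hp
    (MeasurableSet.measurableSet_limsup fun n => measurableSet_openAt _) hup
    (by rw [h1]; exact one_ne_zero) v
  refine fun h0 => this (measure_mono_null ?_ h0)
  rintro ω ⟨hvo, hω⟩
  have hω := ((hA ω).1 hω).image hfinj.injOn
  refine Set.Infinite.mono ?_ hω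
  rintro _ ⟨n, hn, rfl⟩
  exact mem_siteCluster_iff.2 ⟨hvo, Conn.refl.tail (f n).2 (Set.mem_univ _) hn⟩

variable (G) in
/-- Every vertex `x` has a finite neighbourhood `S` such that the expected number of open vertices
outside `S` adjacent to the cluster of `x` in `S` is less than `1`. -/
def IsSubcritical (p : I) : Prop :=
  ∀ x : V, ∃ S : Finset V, x ∈ S ∧ ENNReal.ofReal p * boundarySize G p S x < 1

lemma IsSubcritical.mono {p q : I} (hq : IsSubcritical G q) (hpq : p ≤ q) :
    IsSubcritical G p := by
  intro x
  obtain ⟨S, hx, hS⟩ := hq x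
  refine ⟨S, hx, lt_of_le_of_lt ?_ hS⟩
  gcongr
  exact boundarySize_mono S x hpq

lemma isSubcritical_zero : IsSubcritical G 0 := fun x => ⟨{x}, by simp⟩

lemma IsSubcritical.expectedSize_lt_top [Countable V] (hG : IsQuasiTransitive G) {p : I}
    (h : IsSubcritical G p) (x : V) : expectedSize (siteCluster G) p x < ⊤ := by
  classical
  obtain ⟨F, hF⟩ := hG
  choose S hxS hS using h
  set c : ENNReal := F.sup fun y => ENNReal.ofReal p * boundarySize G p (S y) y
  set M : ℕ := F.sup fun y => (S y).card
  have hc : c < 1 := (Finset.sup_lt_iff (by simp)).2 fun y _ => hS y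
  have hbound := tsum_measure_conn_le (G := G) (p := p) hc (M := M) ?_ x
  · rw [expectedSize_eq_tsum measurableSet_mem_siteCluster]
    refine lt_of_le_of_lt ?_ (hbound.trans_lt ?_)
    · refine ENNReal.tsum_le_tsum fun y => measure_mono fun ω hω => ?_
      exact (mem_siteCluster_iff.1 hω).2
    · exact ENNReal.div_lt_top (ENNReal.natCast_ne_top _) (tsub_pos_of_lt hc).ne'
  · intro z
    obtain ⟨y, hy, γ, rfl⟩ := hF z
    refine ⟨(S y).map γ.toEquiv.toEmbedding, ?_, ?_, ?_⟩
    · exact Finset.mem_map_of_mem _ (hxS y)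
    · rw [Finset.card_map]
      exact Finset.le_sup (f := fun y => (S y).card) hy
    · rw [boundarySize_map]
      exact Finset.le_sup (f := fun y => ENNReal.ofReal p * boundarySize G p (S y) y) hy

/-- Sharpness of the phase transition for site percolation on locally finite graphs. -/
theorem exists_isSharp_siteCluster [Countable V] (hconn : G.Connected) (hG : IsQuasiTransitive G)
    (hfin : ∀ v, (G.neighborSet v).Finite) : ∃ pc, IsSharp (siteCluster G) pc := by
  set s : Set ℝ := {q | ∃ p : I, (p : ℝ) = q ∧ IsSubcritical G p}
  have hbdd : BddAbove s := ⟨1, by rintro _ ⟨p, rfl, -⟩; exact p.2.2⟩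
  have h0 : (0 : ℝ) ∈ s := ⟨0, rfl, isSubcritical_zero⟩
  have hnonneg : 0 ≤ sSup s := le_csSup hbdd h0
  refine ⟨sSup s, hnonneg, csSup_le ⟨0, h0⟩ ?_, ?_, ?_⟩
  · rintro _ ⟨p, rfl, -⟩; exact p.2.2
  · intro p hp x
    obtain ⟨_, ⟨q, rfl, hq⟩, hpq⟩ := exists_lt_of_lt_csSup ⟨0, h0⟩ hp
    exact (hq.mono hpq.le).expectedSize_lt_top hG x
  · intro q hq y
    obtain ⟨r, hr, hrq⟩ := exists_between hq
    let p : I := ⟨r, hnonneg.trans hr.le, hrq.le.trans q.2.2⟩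
    have hp : ¬ IsSubcritical G p := fun h => not_le.2 hr (le_csSup hbdd ⟨p, rfl, h⟩)
    unfold IsSubcritical at hp
    push Not at hp
    obtain ⟨x, hx⟩ := hp
    have hq0 : 0 < (q : ℝ) := hnonneg.trans_lt hq
    have h1 : ∀ S : Finset V, x ∈ S → 1 ≤ boundarySize G p S x := fun S hS =>
      (hx S hS).trans (mul_le_of_le_one_left' (by simpa using p.2.2))
    have hinf := measure_infinite_conn_ne_zero hfin (show p < q from hrq) h1
    refine measure_infinite_siteCluster_ne_zero hconn hq0 (x := x) ?_ y
    have := measure_openAt_inter_ne_zero hq0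
      (measurableSet_infinite (C := fun ω x => {y | Conn G ω Set.univ x y})
        (fun x y => measurableSet_conn _ x y) x) ?_ hinf x
    · refine fun h0 => this (measure_mono_null ?_ h0)
      rintro ω ⟨hxo, hω⟩
      exact Set.Infinite.mono (fun z hz => mem_siteCluster_iff.2 ⟨hxo, hz⟩) hω
    · intro ω ω' h hω
      exact Set.Infinite.mono (fun z hz => Conn.mono hz subset_rfl fun i _ hi =>
        Bool.eq_true_of_true_le (hi ▸ h i)) hω

end Site

/-! ### Bond percolation as site percolation on the line graph -/

section Bond

variable {V : Type*} {G : SimpleGraph V}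

lemma mem_siteCluster_trans {W : Type*} {H : SimpleGraph W} {ω : W → Bool} {e f g : W}
    (hf : f ∈ siteCluster H ω e) (hfg : f = g ∨ H.Adj f g) (hg : ω g = true) :
    g ∈ siteCluster H ω e := by
  rcases hfg with rfl | hfg
  · exact hf
  · rw [mem_siteCluster_iff] at hf ⊢
    exact ⟨hf.1, hf.2.tail hfg (Set.mem_univ _) hg⟩

lemma eq_or_lineGraph_adj {e f : G.edgeSet} {v : V} (he : v ∈ (e : Sym2 V))
    (hf : v ∈ (f : Sym2 V)) : e = f ∨ G.lineGraph.Adj e f := by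
  by_cases h : e = f
  · exact Or.inl h
  · exact Or.inr (SimpleGraph.lineGraph_adj_iff_exists.2 ⟨h, v, he, hf⟩)

/-- The endpoints of an open edge lie in the same bond cluster. -/
lemma bondGraph_reachable_of_mem {ω : G.edgeSet → Bool} {e : G.edgeSet} (he : ω e = true) {x y : V}
    (hx : x ∈ (e : Sym2 V)) (hy : y ∈ (e : Sym2 V)) : (bondGraph G ω).Reachable x y := by
  by_cases hxy : x = y
  · rw [hxy]
  · have : (e : Sym2 V) = s(x, y) := (Sym2.mem_and_mem_iff hxy).1 ⟨hx, hy⟩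
    obtain ⟨e, heG⟩ := e
    subst this
    exact SimpleGraph.Adj.reachable ⟨heG, he⟩

lemma bondGraph_reachable_of_mem_siteCluster {ω : G.edgeSet → Bool} {e f : G.edgeSet}
    (h : f ∈ siteCluster G.lineGraph ω e) {x y : V}
    (hx : x ∈ (e : Sym2 V)) (hy : y ∈ (f : Sym2 V)) : (bondGraph G ω).Reachable x y := by
  obtain ⟨he, h⟩ := mem_siteCluster_iff.1 h
  induction h generalizing y with
  | refl => exact bondGraph_reachable_of_mem he hx hy
  | @tail f g hf hfg ih =>
    obtain ⟨-, v, hv, hv'⟩ := SimpleGraph.lineGraph_adj_iff_exists.1 hfg.1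
    exact (ih (mem_siteCluster_iff.2 ⟨he, hf⟩) hv).trans
      (bondGraph_reachable_of_mem hfg.2.2 hv' hy)

/-- The bond cluster of `x` consists of `x` and of the endpoints of the edges in the site clusters
on the line graph of the edges at `x`. -/
lemma mem_bondCluster_iff {ω : G.edgeSet → Bool} {x y : V} :
    y ∈ bondCluster G ω x ↔ y = x ∨ ∃ e f : G.edgeSet, x ∈ (e : Sym2 V) ∧ y ∈ (f : Sym2 V) ∧
      f ∈ siteCluster G.lineGraph ω e := by
  constructor
  · intro h
    change (bondGraph G ω).Reachable x y at h
    rw [SimpleGraph.reachable_iff_reflTransGen] at h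
    induction h with
    | refl => exact Or.inl rfl
    | @tail b c _ hbc ih =>
      obtain ⟨hG, hω⟩ := hbc
      right
      rcases ih with rfl | ⟨e, f, he, hf, hef⟩
      · exact ⟨⟨s(b, c), hG⟩, ⟨s(b, c), hG⟩, by simp, by simp,
          mem_siteCluster_iff.2 ⟨hω, Conn.refl⟩⟩
      · exact ⟨e, ⟨s(b, c), hG⟩, he, by simp,
          mem_siteCluster_trans hef (eq_or_lineGraph_adj hf (by simp)) hω⟩
  · rintro (rfl | ⟨e, f, he, hf, hef⟩)
    · exact SimpleGraph.Reachable.refl _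
    · exact bondGraph_reachable_of_mem_siteCluster hef he hf

lemma measurableSet_mem_bondCluster [Countable V] (x y : V) :
    MeasurableSet {ω | y ∈ bondCluster G ω x} := by
  have : {ω | y ∈ bondCluster G ω x} = {_ω | y = x} ∪ ⋃ e : G.edgeSet, ⋃ f : G.edgeSet,
      {ω | x ∈ (e : Sym2 V) ∧ y ∈ (f : Sym2 V)} ∩ {ω | f ∈ siteCluster G.lineGraph ω e} := by
    ext ω
    simp only [Set.mem_ofPred_eq, mem_bondCluster_iff, Set.mem_union, Set.mem_iUnion,
      Set.mem_inter_iff, and_assoc]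
  rw [this]
  exact (MeasurableSet.const _).union (MeasurableSet.iUnion fun e => MeasurableSet.iUnion fun f =>
    (MeasurableSet.const _).inter (measurableSet_mem_siteCluster e f))

lemma infinite_bondCluster {ω : G.edgeSet → Bool} {x : V} {e : G.edgeSet}
    (hx : x ∈ (e : Sym2 V)) (h : (siteCluster G.lineGraph ω e).Infinite) :
    (bondCluster G ω x).Infinite := by
  intro hfin
  refine h ?_
  have hfin2 : ((fun q : V × V => s(q.1, q.2)) '' (bondCluster G ω x ×ˢ bondCluster G ω x)).Finite :=
    (hfin.prod hfin).image _
  refine (hfin2.preimage (f := ((↑) : G.edgeSet → Sym2 V))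
    Subtype.val_injective.injOn).subset ?_
  intro f hf
  obtain ⟨a, b, hab⟩ : ∃ a b, (f : Sym2 V) = s(a, b) := by
    induction h' : (f : Sym2 V) with
    | _ a b => exact ⟨a, b, rfl⟩
  refine ⟨(a, b), ⟨?_, ?_⟩, hab.symm⟩
  · exact bondGraph_reachable_of_mem_siteCluster hf hx (by rw [hab]; simp)
  · exact bondGraph_reachable_of_mem_siteCluster hf hx (by rw [hab]; simp)

lemma encard_endpoints_le (C : Set G.edgeSet) :
    {y : V | ∃ f ∈ C, y ∈ (f : Sym2 V)}.encard ≤ 2 * C.encard := by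
  have : ∀ f : G.edgeSet, ∃ q : V × V, (f : Sym2 V) = s(q.1, q.2) := by
    intro f
    induction h' : (f : Sym2 V) with
    | _ a b => exact ⟨(a, b), rfl⟩
  choose q hq using this
  have hsub : {y : V | ∃ f ∈ C, y ∈ (f : Sym2 V)} ⊆
      (fun f => (q f).1) '' C ∪ (fun f => (q f).2) '' C := by
    rintro y ⟨f, hf, hy⟩
    rw [hq f, Sym2.mem_iff] at hy
    rcases hy with rfl | rfl
    exacts [Or.inl ⟨f, hf, rfl⟩, Or.inr ⟨f, hf, rfl⟩]
  calc _ ≤ _ := Set.encard_le_encard hsub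
    _ ≤ _ := Set.encard_union_le _ _
    _ ≤ C.encard + C.encard := add_le_add (Set.encard_image_le _ _) (Set.encard_image_le _ _)
    _ = _ := (two_mul _).symm

lemma encard_bondCluster_le (ω : G.edgeSet → Bool) {x : V} {E : Finset G.edgeSet}
    (hE : ∀ e : G.edgeSet, x ∈ (e : Sym2 V) → e ∈ E) :
    (bondCluster G ω x).encard ≤ 1 + ∑ e ∈ E, 2 * (siteCluster G.lineGraph ω e).encard := by
  classical
  have hsub : bondCluster G ω x ⊆
      {x} ∪ ⋃ e ∈ E, {y | ∃ f ∈ siteCluster G.lineGraph ω e, y ∈ (f : Sym2 V)} := by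
    intro y hy
    rcases mem_bondCluster_iff.1 hy with rfl | ⟨e, f, he, hf, hef⟩
    · exact Or.inl rfl
    · exact Or.inr (Set.mem_biUnion (hE e he) ⟨f, hef, hf⟩)
  have hun : ∀ E : Finset G.edgeSet,
      (⋃ e ∈ E, {y : V | ∃ f ∈ siteCluster G.lineGraph ω e, y ∈ (f : Sym2 V)}).encard ≤
        ∑ e ∈ E, 2 * (siteCluster G.lineGraph ω e).encard := by
    intro E
    induction E using Finset.induction_on with
    | empty => simp
    | insert e E he ih =>
      rw [Finset.set_biUnion_insert, Finset.sum_insert he]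
      exact (Set.encard_union_le _ _).trans (add_le_add (encard_endpoints_le _) ih)
  calc _ ≤ _ := Set.encard_le_encard hsub
    _ ≤ _ := Set.encard_union_le _ _
    _ ≤ _ := add_le_add (by simp) (hun E)

/-- Sharpness for site percolation on the line graph implies sharpness for bond percolation. -/
lemma IsSharp.bondCluster [Countable V] [Nontrivial V] (hconn : G.Connected) {pc : ℝ}
    (h : IsSharp (siteCluster G.lineGraph) pc) (hfin : (∀ v, (G.neighborSet v).Finite) ∨ pc = 0) :
    IsSharp (bondCluster G) pc := by
  refine ⟨h.nonneg, h.le_one, fun p hp x => ?_, fun p hp x => ?_⟩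
  · rcases hfin with hfin | rfl
    · have hinc : {e : G.edgeSet | x ∈ (e : Sym2 V)}.Finite := by
        refine (((hfin x).image fun y => s(x, y)).preimage (f := ((↑) : G.edgeSet → Sym2 V))
          Subtype.val_injective.injOn).subset ?_
        rintro ⟨e, he⟩ hx
        obtain ⟨y, rfl⟩ : ∃ y, e = s(x, y) := hx
        exact ⟨y, he, rfl⟩
      have hle : expectedSize (Percolation.bondCluster G) p x ≤
          1 + ∑ e ∈ hinc.toFinset, 2 * expectedSize (siteCluster G.lineGraph) p e := by
        have hm := fun e => measurable_encard (C := siteCluster G.lineGraph)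
          measurableSet_mem_siteCluster e
        calc expectedSize (Percolation.bondCluster G) p x
            ≤ ∫⁻ ω, (1 + ∑ e ∈ hinc.toFinset,
                2 * ((siteCluster G.lineGraph ω e).encard : ENNReal)) ∂(measure G.edgeSet p) := by
              refine lintegral_mono fun ω => ?_
              have := encard_bondCluster_le ω (x := x) (E := hinc.toFinset) (fun e he => by simpa)
              have := ENat.toENNReal_mono this
              refine this.trans_eq ?_
              rw [ENat.toENNReal_add]
              congr 1
              · simp
              · induction hinc.toFinset using Finset.cons_induction with
                | empty => simp
                | cons e E he ih =>
                  rw [Finset.sum_cons, Finset.sum_cons, ENat.toENNReal_add, ih]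
                  simp
          _ = _ := by
              rw [lintegral_add_left measurable_const,
                lintegral_finsetSum _ fun e _ => (hm e).const_mul 2]
              simp only [lintegral_const, measure_univ, mul_one]
              congr 1
              refine Finset.sum_congr rfl fun e _ => ?_
              rw [lintegral_const_mul _ (hm e)]
              rfl
      refine hle.trans_lt (ENNReal.add_lt_top.2 ⟨ENNReal.one_lt_top, ?_⟩)
      exact ENNReal.sum_lt_top.2 fun e _ =>
        ENNReal.mul_lt_top ENNReal.ofNat_lt_top (h.expectedSize_lt_top p hp e)
    · exact absurd p.2.1 (not_le.2 hp)
  · obtain ⟨y, hxy⟩ := hconn.preconnected.exists_adj_of_nontrivial x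
    exact fun h0 => h.measure_infinite_ne_zero p hp ⟨s(x, y), hxy⟩
      (measure_mono_null (fun ω hω => infinite_bondCluster (by simp) hω) h0)

lemma lineGraph_connected [Nontrivial V] (hconn : G.Connected) : G.lineGraph.Connected := by
  have hne : Nonempty G.edgeSet := by
    obtain ⟨x⟩ := hconn.nonempty
    obtain ⟨y, hxy⟩ := hconn.preconnected.exists_adj_of_nontrivial x
    exact ⟨⟨s(x, y), hxy⟩⟩
  refine ⟨fun e f => ?_⟩
  obtain ⟨x, hx⟩ : ∃ x, x ∈ (e : Sym2 V) := ⟨_, Sym2.out_fst_mem _⟩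
  obtain ⟨y, hy⟩ : ∃ y, y ∈ (f : Sym2 V) := ⟨_, Sym2.out_fst_mem _⟩
  have h := hconn.preconnected x y
  rw [SimpleGraph.reachable_iff_reflTransGen] at h
  have step : ∀ {e f : G.edgeSet} {v : V}, v ∈ (e : Sym2 V) → v ∈ (f : Sym2 V) →
      G.lineGraph.Reachable e f := by
    intro e f v he hf
    rcases eq_or_lineGraph_adj he hf with rfl | h
    exacts [SimpleGraph.Reachable.refl _, h.reachable]
  induction h generalizing f with
  | refl => exact step hx hy
  | @tail b c _ hbc ih =>
    exact (ih ⟨s(b, c), hbc⟩ (by simp)).trans (step (v := c) (by simp) hy)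

lemma lineGraph_neighborSet_finite (hfin : ∀ v, (G.neighborSet v).Finite) (e : G.edgeSet) :
    (G.lineGraph.neighborSet e).Finite := by
  obtain ⟨e, he⟩ := e
  induction e with
  | _ a b =>
    refine ((((hfin a).image fun y => s(a, y)).union ((hfin b).image fun y => s(b, y))).preimage
      (f := ((↑) : G.edgeSet → Sym2 V)) Subtype.val_injective.injOn).subset ?_
    rintro ⟨f, hf⟩ hef
    obtain ⟨-, v, hv, hvf⟩ := SimpleGraph.lineGraph_adj_iff_exists.1 hef
    obtain ⟨y, rfl⟩ : ∃ y, f = s(v, y) := hvf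
    rcases Sym2.mem_iff.1 hv with rfl | rfl
    exacts [Or.inl ⟨y, hf, rfl⟩, Or.inr ⟨y, hf, rfl⟩]

lemma lineGraph_neighborSet_infinite {v : V} (hv : (G.neighborSet v).Infinite) :
    ∃ e, (G.lineGraph.neighborSet e).Infinite := by
  obtain ⟨w, hw⟩ := hv.nonempty
  refine ⟨⟨s(v, w), hw⟩, ?_⟩
  intro hfin
  refine (hv.sdiff (Set.finite_singleton w)) ?_
  refine Set.Finite.subset ((hfin.image ((↑) : G.edgeSet → Sym2 V)).preimage
    (f := fun y => s(v, y)) fun y _ z _ h => Sym2.congr_right.1 h) ?_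
  rintro y ⟨hy, hyw⟩
  refine ⟨⟨s(v, y), hy⟩, SimpleGraph.lineGraph_adj_iff_exists.2 ⟨?_, v, by simp, by simp⟩, rfl⟩
  intro h
  exact hyw (Sym2.congr_right.1 (congrArg Subtype.val h)).symm

lemma lineGraph_isQuasiTransitive (hG : IsQuasiTransitive G)
    (hfin : ∀ v, (G.neighborSet v).Finite) : IsQuasiTransitive G.lineGraph := by
  obtain ⟨F, hF⟩ := hG
  have hE : {e : G.edgeSet | ∃ v ∈ F, v ∈ (e : Sym2 V)}.Finite := by
    refine ((F.finite_toSet.biUnion fun v _ => (hfin v).image fun y => s(v, y)).preimage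
      (f := ((↑) : G.edgeSet → Sym2 V)) Subtype.val_injective.injOn).subset ?_
    rintro ⟨e, he⟩ ⟨v, hv, y, rfl⟩
    exact Set.mem_biUnion hv ⟨y, he, rfl⟩
  refine ⟨hE.toFinset, fun e => ?_⟩
  obtain ⟨x, hx⟩ : ∃ x, x ∈ (e : Sym2 V) := ⟨_, Sym2.out_fst_mem _⟩
  obtain ⟨y, hy, γ, rfl⟩ := hF x
  refine ⟨γ.lineGraph.symm e, ?_, γ.lineGraph, by simp⟩
  rw [Set.Finite.mem_toFinset]
  refine ⟨y, hy, ?_⟩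
  have : ((γ.lineGraph.symm e : G.edgeSet) : Sym2 V) = Sym2.map γ.symm e := rfl
  rw [this, Sym2.mem_map]
  exact ⟨γ y, hx, by simp⟩

end Bond

/-- Site and bond percolation on a connected quasi-transitive graph have sharp phase transitions. If
the graph is not locally finite, both critical points are `0`. -/
theorem exists_isSharp {V : Type*} [Countable V] [Nontrivial V] {G : SimpleGraph V}
    (hconn : G.Connected) (hG : IsQuasiTransitive G) :
    (∃ pc, IsSharp (bondCluster G) pc) ∧ ∃ pc, IsSharp (siteCluster G) pc := by
  have hconn' := lineGraph_connected hconn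
  by_cases hfin : ∀ v, (G.neighborSet v).Finite
  · refine ⟨?_, exists_isSharp_siteCluster hconn hG hfin⟩
    obtain ⟨pc, h⟩ := exists_isSharp_siteCluster hconn' (lineGraph_isQuasiTransitive hG hfin)
      (lineGraph_neighborSet_finite hfin)
    exact ⟨pc, h.bondCluster hconn (Or.inl hfin)⟩
  · push Not at hfin
    obtain ⟨v, hv⟩ := hfin
    obtain ⟨e, he⟩ := lineGraph_neighborSet_infinite hv
    exact ⟨⟨0, (isSharp_siteCluster_zero hconn' he).bondCluster hconn (Or.inr rfl)⟩,
      0, isSharp_siteCluster_zero hconn hv⟩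

end Percolation

theorem theorem1 {V : Type*} [Countable V] [Infinite V] (G : SimpleGraph V)
    (hconn : G.Connected) (hG : IsQuasiTransitive G) :
    -- bond percolation
    ((∀ x y : V, Percolation.pT (Percolation.bondCluster G) x =
        Percolation.pH (Percolation.bondCluster G) y) ∧
      ∀ (p : unitInterval) (x : V), (p : ℝ) < Percolation.pH (Percolation.bondCluster G) x →
        (∀ᵐ ω ∂(Percolation.measure G.edgeSet p),
          ∀ y : V, (Percolation.bondCluster G ω y).Finite) ∧
        ∀ y : V, Percolation.expectedSize (Percolation.bondCluster G) p y < ⊤) ∧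
    -- site percolation
    ((∀ x y : V, Percolation.pT (Percolation.siteCluster G) x =
        Percolation.pH (Percolation.siteCluster G) y) ∧
      ∀ (p : unitInterval) (x : V), (p : ℝ) < Percolation.pH (Percolation.siteCluster G) x →
        (∀ᵐ ω ∂(Percolation.measure V p),
          ∀ y : V, (Percolation.siteCluster G ω y).Finite) ∧
        ∀ y : V, Percolation.expectedSize (Percolation.siteCluster G) p y < ⊤) := by
  obtain ⟨⟨_, hb⟩, _, hs⟩ := Percolation.exists_isSharp hconn hG
  exact ⟨hb.conclusion Percolation.measurableSet_mem_bondCluster,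
    hs.conclusion Percolation.measurableSet_mem_siteCluster⟩
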